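/- For finite simple graphs $G_1, G_2$, let the Ramsey number $R(G_1,G_2)$ be the smallest positive integer $N$ such that for every graph $G$ on $N$ vertices, $G$ contains $G_1$ as a (not necessarily induced) subgraph or the complement $\overline{G}$ contains $G_2$ as a subgraph. Let $W_n = C_n + K_1$ be the wheel on $n+1$ vertices, that is, the cycle $C_n$ on $n$ vertices together with one further vertex adjacent to all vertices of the cycle, and let $S_n = K_{1,n-1}$ be the star on $n$ vertices. For every even integer $n \ge 6$, $$R(W_n,S_n) = \frac{5n}{2}-2 \quad\text{or}\quad R(W_n,S_n) = \frac{5n}{2}-1 .$$ -/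

import Mathlib

/-- The join `G + H` of two graphs: their disjoint union together with all edges between them. -/
def graphJoin {V W : Type*} (G : SimpleGraph V) (H : SimpleGraph W) : SimpleGraph (V ⊕ W) :=
  (G ⊕g H) ⊔ completeBipartiteGraph V W

/-- The wheel `W_m = C_m + K_1`, a graph on `m + 1` vertices. -/
def wheel (m : ℕ) : SimpleGraph (Fin m ⊕ Fin 1) :=
  graphJoin (SimpleGraph.cycleGraph m) (⊤ : SimpleGraph (Fin 1))

/-- The star `S_n = K_{1, n-1}` of order `n` (for `n ≥ 1`). -/
def starOfOrder (n : ℕ) : SimpleGraph (Fin 1 ⊕ Fin (n - 1)) :=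
  completeBipartiteGraph (Fin 1) (Fin (n - 1))

/-- `N` is a positive integer such that for every graph `G` on `N` vertices, `G` contains a (not
necessarily induced) copy of `G₁`, or the complement of `G` contains a copy of `G₂`. -/
def IsRamsey {V W : Type*} (G₁ : SimpleGraph V) (G₂ : SimpleGraph W) (N : ℕ) : Prop :=
  0 < N ∧ ∀ G : SimpleGraph (Fin N), G₁.IsContained G ∨ G₂.IsContained Gᶜ

/-- The Ramsey number `R(G₁, G₂)`: the smallest `N` with `IsRamsey G₁ G₂ N`. The default value `0`
of `sInf` on the empty set is not a possible value otherwise, so a statement that `R(G₁, G₂)` is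
a given positive number includes that such an `N` exists. -/
noncomputable def ramseyNumber {V W : Type*} (G₁ : SimpleGraph V) (G₂ : SimpleGraph W) : ℕ :=
  sInf {N : ℕ | IsRamsey G₁ G₂ N}

/-!
Write `n = 2 k`. The lower bound comes from a graph on `5 k - 3` vertices: an independent set of
`2 k - 1` vertices, completely joined to the disjoint union of a clique on `k` vertices and a complete
bipartite graph with `k - 1` vertices on each side. Its complement has maximum degree `2 k - 2`. If
the hub of a wheel lies in the independent set, then the rim lies in one of two components with at
most `2 k - 2` and `k` vertices; otherwise the rim has at most `k - 1` vertices outside the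
independent set, too few to cover a cycle with `2 k` vertices. Restricting the sizes of the four
classes only from above covers all smaller orders at once
(`not_isContained_wheel_fourPartGraph`, `not_isContained_starOfOrder_compl_fourPartGraph`).

For the upper bound, let `G` have `5 k - 1` vertices. If the complement contains no star of order
`2 k`, then all degrees of `G` are at least `3 k`, and `hasWheel_of_degree_ge` provides a wheel. For
its proof, take `3 k` neighbours of any vertex; they induce a graph `H` of minimum degree at
least `k + 1`. If `H` has a cut vertex, then two sets without edges between them, with
`3 k - 1` vertices in total, give a wheel directly (`hasWheel_of_separated`). Otherwise `H`
contains a cycle with `2 k` vertices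
(`hasCycle_two_mul`), as a longest cycle of `H` shows:

* A longest cycle meets every edge of `H`. If it did not, three vertices would have degree sum at
  most `3 k + 1`, by counting the edges forbidden by maximality
  (`degree_add_degree_add_degree_le`, `not_adj_of_notMem_longest_cycle`).
* If it misses a vertex `y`, then `y` and the successors of its neighbours form an independent set
  with at least `k + 2` vertices. Every vertex of a subset of size `k` has `k + 1` neighbours among
  the at most `2 k - 2` vertices outside the independent set, and a longest cycle alternating
  between the two sets has `2 k` vertices (`hasCycle_of_card_neighbors_between`).
* If it is a Hamiltonian cycle, chords are counted by length. Suitable chords of the lengths `D`,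
  `D + 2 k - 2` and `D + c - 2 k` of a cycle with `c` vertices pairwise produce a cycle with `2 k`
  vertices, so without such a cycle these three lengths account for at most `c` chords
  (`chordCount_add_chordCount_add_chordCount_le`). For `c = 3 k` the degrees then force equality and
  a cycle with `3 k - 1` vertices; for `c = 3 k - 1` they force the missing vertex to be adjacent
  to the whole cycle.
-/

/-! ### Paths and cycles as lists of vertices, and cyclic parametrisations -/

section Cycles

variable {V : Type*} {G : SimpleGraph V}

/-- `l` is the vertex list of a walk of `G` with first vertex `a` and last vertex `b`. Distinctness
of the vertices is not part of the definition. -/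
def IsWalkList (G : SimpleGraph V) (a : V) (l : List V) (b : V) : Prop :=
  l.IsChain G.Adj ∧ l.head? = some a ∧ l.getLast? = some b

/-- `G` contains a cycle with exactly `m` vertices (in particular `3 ≤ m`), given as the list of its
vertices. -/
def HasCycle (G : SimpleGraph V) (m : ℕ) : Prop :=
  ∃ (a b : V) (l : List V), IsWalkList G a l b ∧ G.Adj b a ∧ l.Nodup ∧ l.length = m ∧ 3 ≤ m

/-- A parametrisation of a cycle with `c` vertices of `G` by the natural numbers, periodic with
period `c`. -/
structure IsCyclicParam (G : SimpleGraph V) (c : ℕ) (x : ℕ → V) : Prop where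
  adj : ∀ i, G.Adj (x i) (x (i + 1))
  periodic : ∀ i, x (i + c) = x i
  injOn : ∀ i < c, ∀ j < c, x i = x j → i = j
  three_le : 3 ≤ c

theorem IsWalkList.single (a : V) : IsWalkList G a [a] a := by
  simp [IsWalkList]

theorem IsWalkList.append {a b c d : V} {l l' : List V} (h : IsWalkList G a l b) (hbc : G.Adj b c)
    (h' : IsWalkList G c l' d) : IsWalkList G a (l ++ l') d := by
  obtain ⟨h1, h2, h3⟩ := h
  obtain ⟨h1', h2', h3'⟩ := h'
  refine ⟨h1.append h1' ?_, by simp [h2], by simp [h3']⟩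
  intro x hx y hy
  rw [h3] at hx
  rw [h2'] at hy
  simp only [Option.mem_def, Option.some.injEq] at hx hy
  subst hx hy
  exact hbc

theorem IsWalkList.reverse {a b : V} {l : List V} (h : IsWalkList G a l b) :
    IsWalkList G b l.reverse a := by
  obtain ⟨h1, h2, h3⟩ := h
  refine ⟨?_, by simpa using h3, by simpa using h2⟩
  rw [List.isChain_reverse]
  exact h1.imp fun a b h => h.symm

theorem IsWalkList.left_mem {a b : V} {l : List V} (h : IsWalkList G a l b) : a ∈ l :=
  List.mem_of_mem_head? h.2.1

theorem IsWalkList.right_mem {a b : V} {l : List V} (h : IsWalkList G a l b) : b ∈ l :=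
  List.mem_of_getLast? h.2.2

theorem IsWalkList.length_pos {a b : V} {l : List V} (h : IsWalkList G a l b) : 0 < l.length :=
  List.length_pos_of_mem h.left_mem

theorem IsWalkList.two_le_length {a b : V} {l : List V} (h : IsWalkList G a l b) (hab : a ≠ b) :
    2 ≤ l.length := by
  obtain ⟨_, h2, h3⟩ := h
  match l, h2, h3 with
  | [], h2, _ => simp at h2
  | [c], h2, h3 => simp_all
  | _ :: _ :: _, _, _ => simp

/-- The vertices `x a, x (a + 1), …, x b`; empty if `b < a`. -/
def arc (x : ℕ → V) (a b : ℕ) : List V := (List.range' a (b + 1 - a)).map x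

theorem mem_arc {x : ℕ → V} {a b : ℕ} {v : V} : v ∈ arc x a b ↔ ∃ t, a ≤ t ∧ t ≤ b ∧ x t = v := by
  simp only [arc, List.mem_map, List.mem_range'_1]
  constructor
  · rintro ⟨t, h, rfl⟩
    exact ⟨t, h.1, by omega, rfl⟩
  · rintro ⟨t, h, h', rfl⟩
    exact ⟨t, ⟨h, by omega⟩, rfl⟩

@[simp] theorem length_arc (x : ℕ → V) (a b : ℕ) : (arc x a b).length = b + 1 - a := by
  simp [arc]

namespace IsCyclicParam

variable {c : ℕ} {x : ℕ → V}

theorem apply_mod (h : IsCyclicParam G c x) (i : ℕ) : x (i % c) = x i := by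
  induction i using Nat.strong_induction_on with
  | _ i ih =>
    by_cases hi : i < c
    · rw [Nat.mod_eq_of_lt hi]
    · have h3 := h.three_le
      rw [Nat.mod_eq_sub_mod (by omega), ih (i - c) (by omega), ← h.periodic (i - c)]
      congr 1
      omega

theorem eq_iff (h : IsCyclicParam G c x) {i j : ℕ} : x i = x j ↔ i % c = j % c := by
  have h3 := h.three_le
  constructor
  · intro hij
    rw [← h.apply_mod i, ← h.apply_mod j] at hij
    exact h.injOn _ (Nat.mod_lt _ (by omega)) _ (Nat.mod_lt _ (by omega)) hij
  · intro hij
    rw [← h.apply_mod i, ← h.apply_mod j, hij]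

theorem ne_of_lt (h : IsCyclicParam G c x) {i j : ℕ} (hij : i < j) (hj : j < i + c) :
    x i ≠ x j := by
  rw [Ne, h.eq_iff]
  intro e
  have h1 : (j - i) % c = 0 := by
    have : (i : ℕ) ≡ j [MOD c] := e
    exact Nat.mod_eq_zero_of_dvd ((Nat.modEq_iff_dvd' hij.le).1 this)
  rw [Nat.mod_eq_of_lt (by omega)] at h1
  omega

theorem shift (h : IsCyclicParam G c x) (d : ℕ) : IsCyclicParam G c (fun i => x (d + i)) where
  adj i := h.adj (d + i)
  periodic i := by
    rw [← add_assoc]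
    exact h.periodic _
  injOn i hi j hj e := by
    rcases lt_trichotomy i j with hlt | heq | hlt
    · exact absurd e (h.ne_of_lt (by omega) (by omega))
    · exact heq
    · exact absurd e.symm (h.ne_of_lt (by omega) (by omega))
  three_le := h.three_le

theorem isWalkList_arc (h : IsCyclicParam G c x) {a b : ℕ} (hab : a ≤ b) :
    IsWalkList G (x a) (arc x a b) (x b) := by
  refine ⟨?_, ?_, ?_⟩
  · rw [arc, List.isChain_map]
    refine (List.isChain_range' a (b + 1 - a) 1).imp ?_
    rintro i j rfl
    exact h.adj i
  · simp [arc, List.head?_range', show b + 1 - a ≠ 0 by omega]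
  · simp only [arc, List.getLast?_map, List.getLast?_range', show b + 1 - a ≠ 0 by omega, if_false,
      Option.map_some]
    congr 2
    omega

theorem nodup_arc (h : IsCyclicParam G c x) {a b : ℕ} (hb : b < a + c) : (arc x a b).Nodup := by
  rw [arc, List.nodup_map_iff_inj_on List.nodup_range']
  intro i hi j hj e
  rw [List.mem_range'_1] at hi hj
  rcases lt_trichotomy i j with hlt | heq | hlt
  · exact absurd e (h.ne_of_lt hlt (by omega))
  · exact heq
  · exact absurd e.symm (h.ne_of_lt hlt (by omega))

theorem disjoint_arc (h : IsCyclicParam G c x) {a b a' b' : ℕ} (hb : b < a') (hb' : b' < a + c) :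
    (arc x a b).Disjoint (arc x a' b') := by
  rw [List.disjoint_left]
  intro v hv hv'
  obtain ⟨t, h1, h2, rfl⟩ := mem_arc.1 hv
  obtain ⟨t', h1', h2', e⟩ := mem_arc.1 hv'
  exact h.ne_of_lt (by omega) (by omega) e.symm

theorem hasCycle (h : IsCyclicParam G c x) : HasCycle G c := by
  have h3 := h.three_le
  refine ⟨_, _, arc x 0 (c - 1), h.isWalkList_arc (by omega), ?_, h.nodup_arc (by omega),
    by simp; omega, h3⟩
  have := h.adj (c - 1)
  rwa [show c - 1 + 1 = 0 + c by omega, h.periodic] at this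

theorem exists_eq_of_mem_range (h : IsCyclicParam G c x) {v : V} (hv : v ∈ Set.range x) :
    ∃ i < c, x i = v := by
  obtain ⟨i, rfl⟩ := hv
  have h3 := h.three_le
  exact ⟨i % c, Nat.mod_lt _ (by omega), h.apply_mod i⟩

theorem range_shift (h : IsCyclicParam G c x) (d : ℕ) :
    Set.range (fun i => x (d + i)) = Set.range x := by
  ext v
  constructor
  · rintro ⟨i, rfl⟩
    exact ⟨d + i, rfl⟩
  · rintro ⟨i, rfl⟩
    have h3 := h.three_le
    refine ⟨i + (c - 1) * d, ?_⟩
    have e : d + (i + (c - 1) * d) = i + c * d := by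
      obtain ⟨c', rfl⟩ : ∃ c', c = c' + 1 := ⟨c - 1, by omega⟩
      simp only [Nat.add_sub_cancel]
      ring
    change x (d + (i + (c - 1) * d)) = x i
    rw [e, h.eq_iff, Nat.add_mul_mod_self_left]

end IsCyclicParam

theorem HasCycle.exists_isCyclicParam {m : ℕ} (h : HasCycle G m) :
    ∃ x, IsCyclicParam G m x := by
  obtain ⟨a, b, l, ⟨hc, hh, hl⟩, hba, hn, rfl, h3⟩ := h
  have hlt : ∀ i, i % l.length < l.length := fun i => Nat.mod_lt _ (by omega)
  refine ⟨fun i => l[i % l.length]'(hlt i), ?_, ?_, ?_, h3⟩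
  · intro i
    by_cases hi : i % l.length + 1 < l.length
    · have h1 : (i + 1) % l.length = i % l.length + 1 := by
        rw [Nat.add_mod, Nat.mod_eq_of_lt (show 1 < l.length by omega), Nat.mod_eq_of_lt hi]
      simp only [h1]
      exact List.isChain_iff_getElem.1 hc _ hi
    · have h0 := hlt i
      have h2 : i % l.length = l.length - 1 := by omega
      have h1 : (i + 1) % l.length = 0 := by
        rw [Nat.add_mod, h2, Nat.mod_eq_of_lt (show 1 < l.length by omega),
          show l.length - 1 + 1 = l.length by omega, Nat.mod_self]
      simp only [h1, h2]
      rw [List.head?_eq_getElem?, List.getElem?_eq_getElem (by omega), Option.some.injEq] at hh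
      rw [List.getLast?_eq_getElem?, List.getElem?_eq_getElem (by omega), Option.some.injEq] at hl
      rw [hh, hl]
      exact hba
  · intro i
    simp
  · intro i hi j hj e
    simp only [Nat.mod_eq_of_lt hi, Nat.mod_eq_of_lt hj] at e
    exact (List.Nodup.getElem_inj_iff hn).1 e

theorem HasCycle.le_card [Fintype V] {m : ℕ} (h : HasCycle G m) : m ≤ Fintype.card V := by
  obtain ⟨a, b, l, -, -, hn, rfl, -⟩ := h
  exact hn.length_le_card

theorem HasCycle.mono {G' : SimpleGraph V} (hG : G ≤ G') {m : ℕ} (h : HasCycle G m) :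
    HasCycle G' m := by
  obtain ⟨a, b, l, ⟨h1, h2⟩, hba, hn⟩ := h
  exact ⟨a, b, l, ⟨h1.imp fun _ _ h => hG h, h2⟩, hG hba, hn⟩

/-- A graph of minimum degree at least `2` contains a cycle: the first vertex of a longest path has
a second neighbour on the path. -/
theorem exists_hasCycle_of_two_le_degree [Fintype V] [Nonempty V] [DecidableRel G.Adj]
    (h : ∀ v, 2 ≤ G.degree v) : ∃ m, HasCycle G m := by
  classical
  let P : ℕ → Prop := fun n => ∃ l : List V, l.IsChain G.Adj ∧ l.Nodup ∧ l.length = n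
  have hP1 : P 1 := ⟨[Classical.arbitrary V], by simp⟩
  have hbd : ∀ n, P n → n ≤ Fintype.card V := by
    rintro n ⟨l, -, hn, rfl⟩
    exact hn.length_le_card
  obtain ⟨l, hc, hn, hlen⟩ : P (Nat.findGreatest P (Fintype.card V)) :=
    Nat.findGreatest_spec (hbd 1 hP1) hP1
  have hmax : ∀ n, P n → n ≤ l.length := fun n hn => by
    rw [hlen]
    exact Nat.le_findGreatest (hbd n hn) hn
  have hpos := hmax 1 hP1
  obtain ⟨v, l', rfl⟩ : ∃ v l', l = v :: l' := by
    cases l with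
    | nil => simp at hpos
    | cons v l' => exact ⟨v, l', rfl⟩
  have hsub : ∀ w, G.Adj v w → w ∈ l' := by
    intro w hw
    by_contra hw'
    have hwl : w ∉ v :: l' := by
      simp only [List.mem_cons, not_or]
      exact ⟨hw.ne', hw'⟩
    have := hmax ((v :: l').length + 1) ⟨w :: v :: l', by simpa using ⟨hw.symm, hc⟩,
      List.nodup_cons.2 ⟨hwl, hn⟩, rfl⟩
    omega
  have h2 : 1 < (G.neighborFinset v).card := by
    rw [G.card_neighborFinset_eq_degree]
    exact h v
  obtain ⟨w, l'', rfl⟩ : ∃ w l'', l' = w :: l'' := by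
    cases l' with
    | nil =>
      obtain ⟨a, ha⟩ := Finset.card_pos.1 (by omega : 0 < (G.neighborFinset v).card)
      simpa using hsub a (by simpa using ha)
    | cons w l'' => exact ⟨w, l'', rfl⟩
  obtain ⟨u, hu, huw⟩ := Finset.exists_mem_ne h2 w
  have hu' : G.Adj v u := by simpa using hu
  have hul : u ∈ l'' := by
    rcases List.mem_cons.1 (hsub u hu') with h | h
    · exact absurd h huw
    · exact h
  obtain ⟨s, t, rfl⟩ := List.append_of_mem hul
  refine ⟨_, v, u, v :: w :: (s ++ [u]), ⟨?_, by simp, ?_⟩, hu'.symm, ?_, rfl, by simp⟩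
  · have : v :: w :: (s ++ u :: t) = (v :: w :: (s ++ [u])) ++ t := by simp
    rw [this] at hc
    exact hc.left_of_append
  · rw [← List.cons_append, ← List.cons_append, List.getLast?_append]
    simp
  · have : v :: w :: (s ++ u :: t) = (v :: w :: (s ++ [u])) ++ t := by simp
    rw [this] at hn
    exact hn.of_append_left

end Cycles

/-! ### Longest cycles -/

section LongestCycle

variable {V : Type*} {G : SimpleGraph V} {c : ℕ} {x : ℕ → V}

/-- The spanning subgraph of `G` with the edges of `G` that avoid `S`. -/
def avoiding (G : SimpleGraph V) (S : Set V) : SimpleGraph V where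
  Adj u v := G.Adj u v ∧ u ∉ S ∧ v ∉ S
  symm := ⟨fun _ _ h => ⟨h.1.symm, h.2.2, h.2.1⟩⟩
  loopless := ⟨fun _ h => h.1.ne rfl⟩

/-- No vertex `w` separates `G`: if `w` is removed, every nonempty proper part of the remaining
vertices sends an edge to the rest of them. -/
def NoCutVertex (G : SimpleGraph V) : Prop :=
  ∀ (w : V) (P : Finset V), P.Nonempty → w ∉ P → (∃ q, q ≠ w ∧ q ∉ P) →
    ∃ p ∈ P, ∃ q, q ≠ w ∧ q ∉ P ∧ G.Adj p q

theorem exists_isWalkList_of_reachable {a b : V} (h : G.Reachable a b) :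
    ∃ l, IsWalkList G a l b ∧ l.Nodup ∧ ∀ v ∈ l, G.Reachable a v := by
  classical
  obtain ⟨p, hp⟩ := h.exists_isPath
  refine ⟨p.support, ⟨p.isChain_adj_support, ?_, ?_⟩, hp.support_nodup, ?_⟩
  · rw [List.head?_eq_some_head p.support_ne_nil, p.head_support]
  · rw [List.getLast?_eq_some_getLast p.support_ne_nil, p.getLast_support]
  · intro v hv
    exact ⟨p.takeUntil v hv⟩

theorem disjoint_of_forall_notMem_range {l : List V} {a b : ℕ} (h : ∀ v ∈ l, v ∉ Set.range x) :
    (arc x a b).Disjoint l := by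
  rw [List.disjoint_left]
  intro v hv hv'
  obtain ⟨t, -, -, rfl⟩ := mem_arc.1 hv
  exact h _ hv' ⟨t, rfl⟩

section

variable (hx : IsCyclicParam G c x) (hmax : ∀ m, HasCycle G m → m ≤ c)
  {P : List V} {y z : V} (hP : IsWalkList G y P z) (hPn : P.Nodup)
  (hPx : ∀ v ∈ P, v ∉ Set.range x)

include hx hmax hP hPn hPx

/-- The successors on a longest cycle of the two end attachments of an outside path are not
adjacent. -/
theorem not_adj_succ_succ {a i : ℕ} (hai : a < i) (hic : i < a + c) (hy : G.Adj (x a) y)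
    (hz : G.Adj z (x i)) : ¬ G.Adj (x (i + 1)) (x (a + 1)) := by
  intro hadj
  have w1 := hx.isWalkList_arc (show i + 1 ≤ a + c by omega)
  have w2 := (hx.isWalkList_arc (show a + 1 ≤ i by omega)).reverse
  rw [hx.periodic] at w1
  have hlen := hmax _ ⟨_, _, _, (w1.append hy hP).append hz w2, hadj.symm, ?_, rfl, ?_⟩
  · have := hP.length_pos
    simp only [List.length_append, length_arc, List.length_reverse] at hlen
    omega
  · refine ((hx.nodup_arc (by omega)).append hPn
      (disjoint_of_forall_notMem_range hPx)).append
      (List.nodup_reverse.2 (hx.nodup_arc (by omega))) ?_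
    rw [List.disjoint_append_left, List.disjoint_reverse_right, List.disjoint_reverse_right]
    exact ⟨(hx.disjoint_arc (by omega) (by omega)).symm,
      (disjoint_of_forall_notMem_range hPx).symm⟩
  · have := hP.length_pos
    have := hx.three_le
    simp only [List.length_append, length_arc, List.length_reverse]
    omega

/-- An outside path does not attach to two consecutive vertices of a longest cycle. -/
theorem not_adj_of_adj_succ {i : ℕ} (hy : G.Adj (x i) y) : ¬ G.Adj z (x (i + 1)) := fun hz =>
  not_adj_succ_succ hx hmax hP hPn hPx (Nat.lt_succ_self i)
    (by have := hx.three_le; omega) hy hz (hx.adj (i + 1)).symm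

variable {i : ℕ} (hi : i + 1 < c) (hy : G.Adj (x i) y) (hz : G.Adj z (x (c - 1)))

include hi hy hz

/-- For `m` between the two attachments `i` and `c - 1`, the edges from `x (i + 1)` to `x (m + 1)`
and from `x 0` to `x m` would combine with the outside path to a cycle through all vertices of the
longest cycle and of the path. -/
theorem not_adj_and_adj_of_lt {m : ℕ} (h1 : i < m) (h2 : m + 1 < c) :
    ¬ (G.Adj (x (i + 1)) (x (m + 1)) ∧ G.Adj (x 0) (x m)) := by
  rintro ⟨hu, hw⟩
  have w1 := hx.isWalkList_arc (Nat.zero_le i)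
  have w2 := (hx.isWalkList_arc (show m + 1 ≤ c - 1 by omega)).reverse
  have w3 := hx.isWalkList_arc (show i + 1 ≤ m by omega)
  have hlen := hmax _ ⟨_, _, _, ((w1.append hy hP).append hz w2).append hu.symm w3, hw.symm, ?_,
    rfl, ?_⟩
  · have := hP.length_pos
    simp only [List.length_append, length_arc, List.length_reverse] at hlen
    omega
  · refine (((hx.nodup_arc (by omega)).append hPn
      (disjoint_of_forall_notMem_range hPx)).append
      (List.nodup_reverse.2 (hx.nodup_arc (by omega))) ?_).append (hx.nodup_arc (by omega)) ?_
    · rw [List.disjoint_append_left, List.disjoint_reverse_right, List.disjoint_reverse_right]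
      exact ⟨hx.disjoint_arc (by omega) (by omega), (disjoint_of_forall_notMem_range hPx).symm⟩
    · rw [List.disjoint_append_left, List.disjoint_append_left, List.disjoint_reverse_left]
      exact ⟨⟨hx.disjoint_arc (by omega) (by omega), (disjoint_of_forall_notMem_range hPx).symm⟩,
        (hx.disjoint_arc (by omega) (by omega)).symm⟩
  · have := hP.length_pos
    simp only [List.length_append, length_arc, List.length_reverse]
    omega

/-- The counterpart of `not_adj_and_adj_of_lt` for `m` before both attachments, with the two ends of
the edge of the cycle exchanged. -/
theorem not_adj_and_adj_of_gt {m : ℕ} (h1 : m < i) :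
    ¬ (G.Adj (x (i + 1)) (x m) ∧ G.Adj (x 0) (x (m + 1))) := by
  rintro ⟨hu, hw⟩
  have w1 := hx.isWalkList_arc (Nat.zero_le m)
  have w2 := hx.isWalkList_arc (show i + 1 ≤ c - 1 by omega)
  have w3 := (hx.isWalkList_arc (show m + 1 ≤ i by omega)).reverse
  have hlen := hmax _ ⟨_, _, _, ((w1.append hu.symm w2).append hz.symm hP.reverse).append hy.symm w3,
    hw.symm, ?_, rfl, ?_⟩
  · have := hP.length_pos
    simp only [List.length_append, length_arc, List.length_reverse] at hlen
    omega
  · refine (((hx.nodup_arc (by omega)).append (hx.nodup_arc (by omega))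
      (hx.disjoint_arc (by omega) (by omega))).append
      (List.nodup_reverse.2 hPn) ?_).append (List.nodup_reverse.2 (hx.nodup_arc (by omega))) ?_
    · rw [List.disjoint_reverse_right, List.disjoint_append_left]
      exact ⟨disjoint_of_forall_notMem_range hPx, disjoint_of_forall_notMem_range hPx⟩
    · rw [List.disjoint_reverse_right, List.disjoint_append_left, List.disjoint_append_left,
        List.disjoint_reverse_left]
      exact ⟨⟨hx.disjoint_arc (by omega) (by omega),
        (hx.disjoint_arc (by omega) (by omega)).symm⟩, (disjoint_of_forall_notMem_range hPx).symm⟩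
  · have := hP.length_pos
    simp only [List.length_append, length_arc, List.length_reverse]
    omega

/-- The successors of the two attachments have no common neighbour off the cycle and off the
path. -/
theorem not_adj_and_adj_outside {r : V} (hr : r ∉ Set.range x) (hrP : r ∉ P) :
    ¬ (G.Adj (x (i + 1)) r ∧ G.Adj (x 0) r) := by
  rintro ⟨hu, hw⟩
  have w1 := hx.isWalkList_arc (Nat.zero_le i)
  have w2 := (hx.isWalkList_arc (show i + 1 ≤ c - 1 by omega)).reverse
  have hlen := hmax _ ⟨_, _, _, ((w1.append hy hP).append hz w2).append hu (IsWalkList.single r),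
    hw.symm, ?_, rfl, ?_⟩
  · have := hP.length_pos
    simp only [List.length_append, length_arc, List.length_reverse, List.length_singleton] at hlen
    omega
  · refine (((hx.nodup_arc (by omega)).append hPn
      (disjoint_of_forall_notMem_range hPx)).append
      (List.nodup_reverse.2 (hx.nodup_arc (by omega))) ?_).append (List.nodup_singleton r) ?_
    · rw [List.disjoint_append_left, List.disjoint_reverse_right, List.disjoint_reverse_right]
      exact ⟨hx.disjoint_arc (by omega) (by omega), (disjoint_of_forall_notMem_range hPx).symm⟩
    · have hr' : ∀ v ∈ [r], v ∉ Set.range x := by simpa using hr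
      rw [List.disjoint_append_left, List.disjoint_append_left, List.disjoint_reverse_left]
      exact ⟨⟨disjoint_of_forall_notMem_range hr', List.disjoint_singleton.2 hrP⟩,
        disjoint_of_forall_notMem_range hr'⟩
  · have := hP.length_pos
    simp only [List.length_append, length_arc, List.length_reverse, List.length_singleton]
    omega

omit hi hy in
/-- A detour through an outside path with at least two vertices may bypass one vertex of the
cycle. -/
theorem not_adj_zero_add_two {a : ℕ} (hyz : y ≠ z) (ha : a + 2 < c) (hya : G.Adj (x a) y) :
    ¬ G.Adj (x 0) (x (a + 2)) := by
  intro hw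
  have w1 := hx.isWalkList_arc (Nat.zero_le a)
  have w2 := (hx.isWalkList_arc (show a + 2 ≤ c - 1 by omega)).reverse
  have h2 := hP.two_le_length hyz
  have hlen := hmax _ ⟨_, _, _, (w1.append hya hP).append hz w2, hw.symm, ?_, rfl, ?_⟩
  · simp only [List.length_append, length_arc, List.length_reverse] at hlen
    omega
  · refine ((hx.nodup_arc (by omega)).append hPn
      (disjoint_of_forall_notMem_range hPx)).append
      (List.nodup_reverse.2 (hx.nodup_arc (by omega))) ?_
    rw [List.disjoint_append_left, List.disjoint_reverse_right, List.disjoint_reverse_right]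
    exact ⟨hx.disjoint_arc (by omega) (by omega), (disjoint_of_forall_notMem_range hPx).symm⟩
  · simp only [List.length_append, length_arc, List.length_reverse]
    omega

end

end LongestCycle

section Dominating

variable {V : Type*} [Fintype V] {G : SimpleGraph V} {c : ℕ} {x : ℕ → V}

open Classical in
/-- The degree of a vertex, split into neighbours on and off a cycle. -/
theorem IsCyclicParam.degree_eq (hx : IsCyclicParam G c x) (v : V) :
    G.degree v = ((Finset.range c).filter fun m => G.Adj v (x m)).card +
      ((Finset.univ : Finset V).filter fun r => G.Adj v r ∧ r ∉ Set.range x).card := by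
  have h1 : ((Finset.range c).filter fun m => G.Adj v (x m)).card =
      ((G.neighborFinset v).filter fun r => r ∈ Set.range x).card := by
    refine Finset.card_bij (fun m _ => x m) ?_ ?_ ?_
    · intro m hm
      simp only [Finset.mem_filter, Finset.mem_range] at hm
      simp [hm.2]
    · intro m hm m' hm' e
      simp only [Finset.mem_filter, Finset.mem_range] at hm hm'
      exact hx.injOn _ hm.1 _ hm'.1 e
    · intro r hr
      simp only [Finset.mem_filter, SimpleGraph.mem_neighborFinset] at hr
      obtain ⟨m, hm, rfl⟩ := hx.exists_eq_of_mem_range hr.2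
      exact ⟨m, by simp [hm, hr.1], rfl⟩
  have h2 : ((Finset.univ : Finset V).filter fun r => G.Adj v r ∧ r ∉ Set.range x) =
      (G.neighborFinset v).filter fun r => r ∉ Set.range x := by
    ext r
    simp
  rw [h1, h2, Finset.card_filter_add_card_filter_not, G.card_neighborFinset_eq_degree]

open Classical in
theorem IsCyclicParam.card_outside (hx : IsCyclicParam G c x) :
    c + ((Finset.univ : Finset V).filter fun r => r ∉ Set.range x).card = Fintype.card V := by
  have h1 : c = ((Finset.univ : Finset V).filter fun r => r ∈ Set.range x).card := by
    conv_lhs => rw [← Finset.card_range c]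
    refine Finset.card_bij (fun m _ => x m) ?_ ?_ ?_
    · intro m _
      simp
    · intro m hm m' hm' e
      simp only [Finset.mem_range] at hm hm'
      exact hx.injOn _ hm _ hm' e
    · intro r hr
      simp only [Finset.mem_filter, Finset.mem_univ, true_and] at hr
      obtain ⟨m, hm, rfl⟩ := hx.exists_eq_of_mem_range hr
      exact ⟨m, by simp [hm], rfl⟩
  conv_lhs => enter [1]; rw [h1]
  rw [Finset.card_filter_add_card_filter_not, Finset.card_univ]

open Classical in
/-- If `y ≠ z` lie in one component off a longest cycle, `y` is attached at `x i`, `z` is attached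
at `x (c - 1)`, and `y` is not attached strictly between the two, then the degrees of `x (i + 1)`,
`x 0` and `y` add up to at most `|V| + 1`. -/
theorem degree_add_degree_add_degree_le (hx : IsCyclicParam G c x)
    (hmax : ∀ m, HasCycle G m → m ≤ c) {y z : V} (hyx : y ∉ Set.range x) (hyz : y ≠ z)
    (hreach : (avoiding G (Set.range x)).Reachable y z) {i : ℕ} (hi : i + 1 < c)
    (hy : G.Adj (x i) y) (hz : G.Adj z (x (c - 1)))
    (hlast : ∀ a, i < a → a < c - 1 → ¬ G.Adj y (x a)) :
    G.degree (x (i + 1)) + G.degree (x 0) + G.degree y ≤ Fintype.card V + 1 := by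
  set H := avoiding G (Set.range x) with hH
  have hHG : H ≤ G := fun u v h => h.1
  have hout : ∀ v, H.Reachable y v → v ∉ Set.range x := by
    intro v hv
    by_cases h : y = v
    · exact h ▸ hyx
    · obtain ⟨p⟩ := hv.symm
      cases p with
      | nil => exact absurd rfl h
      | cons hadj _ => exact hadj.2.1
  -- Outside paths join any two vertices of the component of `y`.
  have hpath : ∀ b b', H.Reachable y b → H.Reachable y b' → ∃ P, IsWalkList G b P b' ∧ P.Nodup ∧
      (∀ v ∈ P, v ∉ Set.range x) ∧ ∀ v ∈ P, H.Reachable y v := by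
    intro b b' hb hb'
    obtain ⟨P, ⟨h1, h2⟩, h3, h4⟩ := exists_isWalkList_of_reachable (hb.symm.trans hb')
    exact ⟨P, ⟨h1.imp fun _ _ h => hHG h, h2⟩, h3, fun v hv => hout v (hb.trans (h4 v hv)),
      fun v hv => hb.trans (h4 v hv)⟩
  obtain ⟨P, hP, hPn, hPx, hPr⟩ := hpath y z (SimpleGraph.Reachable.refl y) hreach
  have hyw : IsWalkList G y [y] y := IsWalkList.single y
  have hyw' : ∀ v ∈ [y], v ∉ Set.range x := by simpa using hyx
  set T := (Finset.range i).filter fun a => G.Adj y (x a) with hT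
  set U := (Finset.range c).filter fun m => G.Adj (x (i + 1)) (x m) with hU
  set W := (Finset.range c).filter fun m => G.Adj (x 0) (x m) with hW
  -- Neighbours on the cycle: each neighbour of `x (i + 1)` is moved by `f` to a cycle vertex that
  -- cannot be a neighbour of `x 0`, and for a neighbour `x a` of `y` with `a < i` the same holds
  -- for `x (a + 2)`; all these vertices are distinct.
  have hC : U.card + T.card + W.card ≤ c := by
    let f : ℕ → ℕ := fun m => if i < m then m - 1 else if m = i then 0 else m + 1
    have hi1 : i + 1 ∉ U := by simp [hU]
    have hfinj : Set.InjOn f U := by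
      intro m hm m' hm' e
      have h1 : m ≠ i + 1 := fun h => hi1 (h ▸ hm)
      have h2 : m' ≠ i + 1 := fun h => hi1 (h ▸ hm')
      simp only [f] at e
      split_ifs at e <;> omega
    have hginj : Set.InjOn (fun a => a + 2) (T : Set ℕ) := fun a _ b _ e => by
      simpa using e
    rw [← Finset.card_image_of_injOn hfinj, ← Finset.card_image_of_injOn hginj,
      ← Finset.card_union_of_disjoint, ← Finset.card_union_of_disjoint]
    · conv_rhs => rw [← Finset.card_range c]
      refine Finset.card_le_card ?_
      intro m hm
      simp only [Finset.mem_union, Finset.mem_image] at hm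
      rw [Finset.mem_range]
      rcases hm with (⟨a, ha, rfl⟩ | ⟨a, ha, rfl⟩) | hm
      · have := (Finset.mem_filter.1 ha).1
        rw [Finset.mem_range] at this
        simp only [f]
        split_ifs <;> omega
      · have := (Finset.mem_filter.1 ha).1
        rw [Finset.mem_range] at this
        omega
      · simpa using (Finset.mem_filter.1 hm).1
    · rw [Finset.disjoint_left]
      intro m hm hmW
      have hmW' : G.Adj (x 0) (x m) := (Finset.mem_filter.1 hmW).2
      simp only [Finset.mem_union, Finset.mem_image] at hm
      rcases hm with ⟨a, ha, rfl⟩ | ⟨a, ha, rfl⟩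
      · have ha1 : a ≠ i + 1 := fun h => hi1 (h ▸ ha)
        obtain ⟨hac, hadj⟩ := Finset.mem_filter.1 ha
        rw [Finset.mem_range] at hac
        simp only [f] at hmW'
        split_ifs at hmW' with h1 h2
        · refine not_adj_and_adj_of_lt hx hmax hP hPn hPx hi hy hz (m := a - 1) (by omega)
            (by omega) ⟨?_, hmW'⟩
          rwa [show a - 1 + 1 = a by omega]
        · exact hmW'.ne rfl
        · exact not_adj_and_adj_of_gt hx hmax hP hPn hPx hi hy hz (m := a) (by omega)
            ⟨hadj, hmW'⟩
      · obtain ⟨hac, hadj⟩ := Finset.mem_filter.1 ha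
        rw [Finset.mem_range] at hac
        exact not_adj_zero_add_two hx hmax hP hPn hPx hz hyz (by omega) hadj.symm hmW'
    · rw [Finset.disjoint_left]
      intro m hm hm'
      simp only [Finset.mem_image] at hm hm'
      obtain ⟨a, ha, rfl⟩ := hm
      obtain ⟨b, hb, e⟩ := hm'
      have ha1 : a ≠ i + 1 := fun h => hi1 (h ▸ ha)
      obtain ⟨hbi, hbadj⟩ := Finset.mem_filter.1 hb
      rw [Finset.mem_range] at hbi
      have hbi' : b + 1 ≠ i := by
        rintro rfl
        exact not_adj_of_adj_succ hx hmax hyw (List.nodup_singleton y) hyw' hbadj.symm hy.symm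
      have hab : a = b + 1 := by
        simp only [f] at e
        split_ifs at e <;> omega
      subst hab
      exact not_adj_succ_succ hx hmax hyw (List.nodup_singleton y) hyw' hbi (by omega) hbadj.symm
        hy.symm (Finset.mem_filter.1 ha).2
  -- Neighbours off the cycle: those of `x (i + 1)`, those of `x 0` and the component of `y` are
  -- disjoint.
  set B := (Finset.univ : Finset V).filter fun v => H.Reachable y v with hB
  set U' := (Finset.univ : Finset V).filter fun r => G.Adj (x (i + 1)) r ∧ r ∉ Set.range x with hU'
  set W' := (Finset.univ : Finset V).filter fun r => G.Adj (x 0) r ∧ r ∉ Set.range x with hW'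
  have hUB : ∀ r ∈ U', ¬ H.Reachable y r := by
    intro r hr hyr
    obtain ⟨Q, hQ, hQn, hQx, -⟩ := hpath y r (SimpleGraph.Reachable.refl y) hyr
    exact not_adj_of_adj_succ hx hmax hQ hQn hQx hy (Finset.mem_filter.1 hr).2.1.symm
  have hWB : ∀ r ∈ W', ¬ H.Reachable y r := by
    intro r hr hyr
    obtain ⟨Q, hQ, hQn, hQx, -⟩ := hpath z r hreach hyr
    refine not_adj_of_adj_succ hx hmax hQ hQn hQx hz.symm ?_
    rw [show c - 1 + 1 = 0 + c by omega, hx.periodic]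
    exact (Finset.mem_filter.1 hr).2.1.symm
  have hR : U'.card + W'.card + B.card ≤
      ((Finset.univ : Finset V).filter fun r => r ∉ Set.range x).card := by
    rw [← Finset.card_union_of_disjoint, ← Finset.card_union_of_disjoint]
    · refine Finset.card_le_card ?_
      intro r hr
      simp only [Finset.mem_union] at hr
      rw [Finset.mem_filter]
      refine ⟨Finset.mem_univ _, ?_⟩
      rcases hr with (hr | hr) | hr
      · exact (Finset.mem_filter.1 hr).2.2
      · exact (Finset.mem_filter.1 hr).2.2
      · exact hout r (Finset.mem_filter.1 hr).2
    · rw [Finset.disjoint_left]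
      intro r hr hrB
      rcases Finset.mem_union.1 hr with hr | hr
      · exact hUB r hr (Finset.mem_filter.1 hrB).2
      · exact hWB r hr (Finset.mem_filter.1 hrB).2
    · rw [Finset.disjoint_left]
      intro r hr hr'
      exact not_adj_and_adj_outside hx hmax hP hPn hPx hi hy hz (Finset.mem_filter.1 hr).2.2
        (fun h => hUB r hr (hPr r h)) ⟨(Finset.mem_filter.1 hr).2.1, (Finset.mem_filter.1 hr').2.1⟩
  -- The neighbours `x i` and `x (c - 1)` of `y` are not counted in `T`, which gives a surplus of `2`;
  -- `y` itself lies in its component, which takes back `1`.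
  have hy1 : ((Finset.range c).filter fun m => G.Adj y (x m)).card ≤ T.card + 2 := by
    have : ((Finset.range c).filter fun m => G.Adj y (x m)) ⊆ insert i (insert (c - 1) T) := by
      intro m hm
      obtain ⟨hmc, hadj⟩ := Finset.mem_filter.1 hm
      rw [Finset.mem_range] at hmc
      simp only [Finset.mem_insert, hT, Finset.mem_filter, Finset.mem_range]
      rcases lt_trichotomy m i with h | h | h
      · exact Or.inr (Or.inr ⟨h, hadj⟩)
      · exact Or.inl h
      · right; left
        by_contra h'
        exact hlast m h (by omega) hadj
    have h1 := Finset.card_le_card this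
    have h2 := Finset.card_insert_le i (insert (c - 1) T)
    have h3 := Finset.card_insert_le (c - 1) T
    omega
  have hy2 : ((Finset.univ : Finset V).filter fun r => G.Adj y r ∧ r ∉ Set.range x).card + 1 ≤
      B.card := by
    rw [← Finset.card_insert_of_notMem (a := y) (by simp)]
    refine Finset.card_le_card ?_
    intro r hr
    rw [Finset.mem_filter]
    refine ⟨Finset.mem_univ _, ?_⟩
    rcases Finset.mem_insert.1 hr with rfl | hr
    · exact SimpleGraph.Reachable.refl _
    · have := (Finset.mem_filter.1 hr).2
      exact SimpleGraph.Adj.reachable (show H.Adj y r from ⟨this.1, hyx, this.2⟩)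
  have e1 := hx.degree_eq (x (i + 1))
  have e2 := hx.degree_eq (x 0)
  have e3 := hx.degree_eq y
  have e4 := hx.card_outside
  rw [← hU, ← hU'] at e1
  rw [← hW, ← hW'] at e2
  omega

open Classical in
/-- In a graph without cut vertex and with `3 δ ≥ |V| + 2`, the vertices off a longest cycle are
pairwise nonadjacent. -/
theorem not_adj_of_notMem_longest_cycle (hx : IsCyclicParam G c x)
    (hmax : ∀ m, HasCycle G m → m ≤ c) (hcut : NoCutVertex G) {d : ℕ} (hd : ∀ v, d ≤ G.degree v)
    (hdn : Fintype.card V + 2 ≤ 3 * d) {y₀ y₁ : V} (h0 : y₀ ∉ Set.range x)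
    (h1 : y₁ ∉ Set.range x) : ¬ G.Adj y₀ y₁ := by
  intro hadj
  set H := avoiding G (Set.range x) with hH
  have h01 : H.Adj y₀ y₁ := ⟨hadj, h0, h1⟩
  have hout : ∀ v, H.Reachable y₀ v → v ∉ Set.range x := by
    intro v hv
    by_cases h : y₀ = v
    · exact h ▸ h0
    · obtain ⟨p⟩ := hv.symm
      cases p with
      | nil => exact absurd rfl h
      | cons hadj _ => exact hadj.2.1
  -- Edges leave the component of `y₀` in the complement of the cycle only towards the cycle.
  have hcomp : ∀ b q, H.Reachable y₀ b → ¬ H.Reachable y₀ q → G.Adj b q → q ∈ Set.range x := by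
    intro b q hb hq hbq
    by_contra h
    exact hq (hb.trans (SimpleGraph.Adj.reachable (show H.Adj b q from ⟨hbq, hout b hb, h⟩)))
  have hx3 := hx.three_le
  have hxr : ∀ i, ¬ H.Reachable y₀ (x i) := fun i h => hout _ h ⟨i, rfl⟩
  -- As there is no cut vertex, two disjoint edges join the component to the cycle.
  obtain ⟨y, z, i, j, hy, hz, hyz, hij, hyi, hzj⟩ : ∃ y z i j, H.Reachable y₀ y ∧
      H.Reachable y₀ z ∧ y ≠ z ∧ x i ≠ x j ∧ G.Adj y (x i) ∧ G.Adj z (x j) := by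
    by_contra hno
    have hno' : ∀ y z i j, H.Reachable y₀ y → H.Reachable y₀ z → y ≠ z → G.Adj y (x i) →
        G.Adj z (x j) → x i = x j := by
      intro y z i j hy hz hyz hyi hzj
      by_contra hij
      exact hno ⟨y, z, i, j, hy, hz, hyz, hij, hyi, hzj⟩
    by_cases hb : ∃ b, H.Reachable y₀ b ∧ ∀ b' i, H.Reachable y₀ b' → G.Adj b' (x i) → b' = b
    · obtain ⟨b, hbr, hb⟩ := hb
      obtain ⟨p, hp, q, hqb, hqP, hpq⟩ := hcut b
        ((Finset.univ : Finset V).filter fun v => H.Reachable y₀ v ∧ v ≠ b) (by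
          by_cases h : y₀ = b
          · exact ⟨y₁, by simp [h01.reachable, ← h, hadj.ne']⟩
          · exact ⟨y₀, by simp [h]⟩) (by simp) ⟨x 0, by
          refine ⟨?_, by simp [hxr 0]⟩
          rintro rfl
          exact hxr 0 hbr⟩
      simp only [Finset.mem_filter, Finset.mem_univ, true_and] at hp hqP
      have hq : ¬ H.Reachable y₀ q := fun h => hqP ⟨h, hqb⟩
      obtain ⟨t, rfl⟩ := hcomp p q hp.1 hq hpq
      exact hp.2 (hb p t hp.1 hpq)
    · push Not at hb
      obtain ⟨b₁, i₁, hr1, ha1, -⟩ := hb y₀ (SimpleGraph.Reachable.refl _)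
      obtain ⟨b₂, i₂, hr2, ha2, hne⟩ := hb b₁ hr1
      have e12 := hno' b₁ b₂ i₁ i₂ hr1 hr2 hne.symm ha1 ha2
      obtain ⟨p, hp, q, hqb, hqP, hpq⟩ := hcut (x i₁)
        ((Finset.univ : Finset V).filter fun v => H.Reachable y₀ v) ⟨y₀, by simp⟩
        (by simpa using hxr i₁) ⟨x (i₁ + 1), (hx.adj i₁).ne', by simpa using hxr (i₁ + 1)⟩
      simp only [Finset.mem_filter, Finset.mem_univ, true_and] at hp hqP
      obtain ⟨t, rfl⟩ := hcomp p q hp hqP hpq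
      by_cases h : p = b₁
      · subst h
        exact hqb ((hno' p b₂ t i₂ hp hr2 hne.symm hpq ha2).trans e12.symm)
      · exact hqb (hno' p b₁ t i₁ hp hr1 h hpq ha1)
  -- The parametrisation is shifted such that `x j` gets the index `c - 1`.
  have hx' := hx.shift (j + 1)
  have hr' := hx.range_shift (j + 1)
  set x' : ℕ → V := fun m => x (j + 1 + m) with hx'def
  have hlastj : x' (c - 1) = x j := by
    simp only [hx'def]
    rw [show j + 1 + (c - 1) = j + c by omega, hx.periodic]
  have hex : ∃ a < c - 1, G.Adj y (x' a) := by
    obtain ⟨a, ha, e⟩ := hx'.exists_eq_of_mem_range (v := x i) (by rw [hr']; exact ⟨i, rfl⟩)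
    refine ⟨a, ?_, by rw [e]; exact hyi⟩
    rcases Nat.lt_or_ge a (c - 1) with h | h
    · exact h
    · rw [show a = c - 1 by omega, hlastj] at e
      exact absurd e.symm hij
  set i' := Nat.findGreatest (fun a => a < c - 1 ∧ G.Adj y (x' a)) (c - 1) with hi'
  obtain ⟨a, ha, hay⟩ := hex
  have hi'spec : i' < c - 1 ∧ G.Adj y (x' i') :=
    Nat.findGreatest_spec (P := fun a => a < c - 1 ∧ G.Adj y (x' a)) ha.le ⟨ha, hay⟩
  have hfin := degree_add_degree_add_degree_le hx' hmax (y := y) (z := z)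
    (by rw [hr']; exact hout y hy) hyz (by rw [hr']; exact hy.symm.trans hz) (i := i')
    (by omega) hi'spec.2.symm (by rw [hlastj]; exact hzj) (by
      intro a h1 h2 h3
      exact Nat.findGreatest_is_greatest h1 h2.le ⟨h2, h3⟩)
  have := hd (x' (i' + 1))
  have := hd (x' 0)
  have := hd y
  omega

open Classical in
/-- If a longest cycle misses a vertex but no edge, then there is an independent set with more than
`d` vertices, where `d` is a lower bound for the degrees: a vertex off the cycle together with the
successors of its neighbours. -/
theorem exists_isIndepSet_of_longest_cycle (hx : IsCyclicParam G c x)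
    (hmax : ∀ m, HasCycle G m → m ≤ c) {d : ℕ} {y : V} (hd : d ≤ G.degree y)
    (hy : y ∉ Set.range x) (hR : ∀ r, r ∉ Set.range x → ¬ G.Adj y r) :
    ∃ I : Finset V, d + 1 ≤ I.card ∧ ∀ u ∈ I, ∀ v ∈ I, ¬ G.Adj u v := by
  have hyw : IsWalkList G y [y] y := IsWalkList.single y
  have hyn : [y].Nodup := List.nodup_singleton y
  have hyw' : ∀ v ∈ [y], v ∉ Set.range x := by simpa using hy
  set T := (Finset.range c).filter fun m => G.Adj y (x m) with hT
  have hTd : d ≤ T.card := by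
    have h1 := hx.degree_eq y
    have h2 : ((Finset.univ : Finset V).filter fun r => G.Adj y r ∧ r ∉ Set.range x) = ∅ := by
      ext r
      simp only [Finset.mem_filter, Finset.mem_univ, true_and, Finset.notMem_empty, iff_false]
      exact fun h => hR r h.2 h.1
    rw [h2, Finset.card_empty, ← hT] at h1
    omega
  have hTadj : ∀ a ∈ T, a < c ∧ G.Adj y (x a) := fun a ha => by simpa [hT] using ha
  have hyT : ∀ a ∈ T, ¬ G.Adj y (x (a + 1)) := fun a ha =>
    not_adj_of_adj_succ hx hmax hyw hyn hyw' (hTadj a ha).2.symm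
  have hTT : ∀ a ∈ T, ∀ b ∈ T, a < b → ¬ G.Adj (x (b + 1)) (x (a + 1)) := fun a ha b hb hab =>
    not_adj_succ_succ hx hmax hyw hyn hyw' hab (by have := (hTadj b hb).1; omega)
      (hTadj a ha).2.symm (hTadj b hb).2
  refine ⟨insert y (T.image fun a => x (a + 1)), ?_, ?_⟩
  · rw [Finset.card_insert_of_notMem, Finset.card_image_of_injOn]
    · omega
    · intro a ha b hb e
      have ha' := (hTadj a ha).1
      have hb' := (hTadj b hb).1
      rcases lt_trichotomy a b with h | h | h
      · exact absurd e (hx.ne_of_lt (by omega) (by omega))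
      · exact h
      · exact absurd e.symm (hx.ne_of_lt (by omega) (by omega))
    · intro h
      obtain ⟨a, -, e⟩ := Finset.mem_image.1 h
      exact hy ⟨a + 1, e⟩
  · intro u hu v hv
    rcases Finset.mem_insert.1 hu with rfl | hu
    · rcases Finset.mem_insert.1 hv with rfl | hv
      · exact G.loopless.irrefl _
      · obtain ⟨a, ha, rfl⟩ := Finset.mem_image.1 hv
        exact hyT a ha
    · obtain ⟨a, ha, rfl⟩ := Finset.mem_image.1 hu
      rcases Finset.mem_insert.1 hv with rfl | hv
      · exact fun h => hyT a ha h.symm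
      · obtain ⟨b, hb, rfl⟩ := Finset.mem_image.1 hv
        rcases lt_trichotomy a b with h | rfl | h
        · exact fun h' => hTT a ha b hb h h'.symm
        · exact G.loopless.irrefl _
        · exact hTT b hb a ha h

end Dominating

/-! ### Chords of Hamiltonian and almost Hamiltonian cycles -/

section Chords

variable {V : Type*} {G : SimpleGraph V} {c k : ℕ} {x : ℕ → V}

theorem sum_range_add_of_periodic {f : ℕ → ℕ} (hf : ∀ i, f (i + c) = f i) (d : ℕ) :
    ∑ i ∈ Finset.range c, f (i + d) = ∑ i ∈ Finset.range c, f i := by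
  induction d with
  | zero => rfl
  | succ d ih =>
    rw [← ih]
    have h1 := Finset.sum_range_succ (fun i => f (i + d)) c
    have h2 := Finset.sum_range_succ' (fun i => f (i + d)) c
    have h3 : f (c + d) = f (0 + d) := by rw [add_comm c d, hf, zero_add]
    have h4 : ∑ i ∈ Finset.range c, f (i + 1 + d) = ∑ i ∈ Finset.range c, f (i + (d + 1)) :=
      Finset.sum_congr rfl fun i _ => by rw [add_right_comm, add_assoc]
    rw [← h4]
    omega

open Classical in
/-- The number of chords of length `D` of the cycle `x 0, …, x (c - 1)`, or more precisely of
indices `i < c` such that `x i` and `x (i + D)` are adjacent. -/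
noncomputable def chordCount (G : SimpleGraph V) (c : ℕ) (x : ℕ → V) (D : ℕ) : ℕ :=
  ∑ i ∈ Finset.range c, if G.Adj (x i) (x (i + D)) then 1 else 0

theorem chordCount_le (D : ℕ) : chordCount G c x D ≤ c := by
  classical
  unfold chordCount
  calc _ ≤ ∑ i ∈ Finset.range c, 1 := Finset.sum_le_sum fun i _ => by split_ifs <;> simp
    _ = c := by simp

open Classical in
theorem IsCyclicParam.chordCount_shift (hx : IsCyclicParam G c x) (D d : ℕ) :
    ∑ i ∈ Finset.range c, (if G.Adj (x (i + d)) (x (i + d + D)) then 1 else 0) =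
      chordCount G c x D := by
  refine sum_range_add_of_periodic (f := fun i => if G.Adj (x i) (x (i + D)) then 1 else 0) ?_ d
  intro i
  rw [hx.periodic, show i + c + D = i + D + c by omega, hx.periodic]

theorem IsCyclicParam.chordCount_symm (hx : IsCyclicParam G c x) {D : ℕ} (hD : D ≤ c) :
    chordCount G c x (c - D) = chordCount G c x D := by
  classical
  rw [← hx.chordCount_shift D (c - D)]
  refine Finset.sum_congr rfl fun i _ => ?_
  rw [show i + (c - D) + D = i + c by omega, hx.periodic, G.adj_comm]

open Classical in
/-- The chord counts of all lengths add up to the degree sum in the subgraph induced by the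
cycle. -/
theorem IsCyclicParam.sum_chordCount (hx : IsCyclicParam G c x) :
    ∑ D ∈ Finset.Ico 1 c, chordCount G c x D =
      ∑ i ∈ Finset.range c, ((Finset.range c).filter fun m => G.Adj (x i) (x m)).card := by
  have h3 := hx.three_le
  unfold chordCount
  rw [Finset.sum_comm]
  refine Finset.sum_congr rfl fun i _ => ?_
  rw [Finset.card_filter, ← sum_range_add_of_periodic
    (f := fun m => if G.Adj (x i) (x m) then 1 else 0) (fun m => by rw [hx.periodic]) i,
    Finset.range_eq_Ico, Finset.sum_eq_sum_Ico_succ_bot (by omega : 0 < c)]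
  simp only [zero_add, SimpleGraph.irrefl, if_false]
  exact Finset.sum_congr rfl fun D _ => by rw [add_comm i D]

theorem IsCyclicParam.not_adj_two_mul_sub_one (hx : IsCyclicParam G c x) (hk : 2 ≤ k)
    (hkc : 2 * k ≤ c) (hno : ¬ HasCycle G (2 * k)) (i : ℕ) :
    ¬ G.Adj (x i) (x (i + (2 * k - 1))) := by
  intro h
  refine hno ⟨_, _, arc x i (i + (2 * k - 1)), hx.isWalkList_arc (by omega), h.symm,
    hx.nodup_arc (by omega), ?_, by omega⟩
  rw [length_arc]
  omega

theorem IsCyclicParam.chordCount_two_mul_sub_one (hx : IsCyclicParam G c x) (hk : 2 ≤ k)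
    (hkc : 2 * k ≤ c) (hno : ¬ HasCycle G (2 * k)) : chordCount G c x (2 * k - 1) = 0 := by
  classical
  refine Finset.sum_eq_zero fun i _ => ?_
  rw [if_neg (hx.not_adj_two_mul_sub_one hk hkc hno i)]

section

variable (hx : IsCyclicParam G c x) (hno : ¬ HasCycle G (2 * k)) {D : ℕ} (hD : 1 ≤ D)
  (hDk : D ≤ k) (hkc : 3 * k ≤ c + 1) (hk : 2 ≤ k)

include hx hno hD hDk hkc hk

/-- Two nested chords would join two arcs with `k` vertices each to a cycle. -/
theorem not_adj_nested :
    ¬ (G.Adj (x (k - 1)) (x (k - 1 + D)) ∧ G.Adj (x 0) (x (D + 2 * k - 2))) := by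
  rintro ⟨h1, h2⟩
  refine hno ⟨_, _, _, (hx.isWalkList_arc (Nat.zero_le (k - 1))).append h1
    (hx.isWalkList_arc (show k - 1 + D ≤ D + 2 * k - 2 by omega)), h2.symm, ?_, ?_, by omega⟩
  · exact (hx.nodup_arc (by omega)).append (hx.nodup_arc (by omega))
      (hx.disjoint_arc (by omega) (by omega))
  · simp only [List.length_append, length_arc]
    omega

/-- The chords from `x (k - 1)` and from the next vertex `x k` would join an arc with `D` vertices,
traversed backwards, to an arc with `2 k - D` vertices. -/
theorem not_adj_crossing_left :
    ¬ (G.Adj (x (k - 1)) (x (k - 1 + D)) ∧ G.Adj (x k) (x (D + c - k))) := by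
  rintro ⟨h1, h2⟩
  have w1 := (hx.isWalkList_arc (show k ≤ k - 1 + D by omega)).reverse
  have w2 := hx.isWalkList_arc (show D + c - k ≤ k - 1 + c by omega)
  rw [hx.periodic] at w2
  refine hno ⟨_, _, _, w1.append h2 w2, h1, ?_, ?_, by omega⟩
  · refine (List.nodup_reverse.2 (hx.nodup_arc (by omega))).append (hx.nodup_arc (by omega)) ?_
    rw [List.disjoint_reverse_left]
    exact hx.disjoint_arc (by omega) (by omega)
  · simp only [List.length_append, length_arc, List.length_reverse]
    omega

/-- The chords from `x 0` and `x k` would join an arc with `D + k - 1` vertices to an arc with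
`k + 1 - D` vertices, traversed backwards. -/
theorem not_adj_crossing_right :
    ¬ (G.Adj (x 0) (x (D + 2 * k - 2)) ∧ G.Adj (x k) (x (D + c - k))) := by
  rintro ⟨h1, h2⟩
  have w1 := hx.isWalkList_arc (show k ≤ D + 2 * k - 2 by omega)
  have w2 := (hx.isWalkList_arc (show D + c - k ≤ 0 + c by omega)).reverse
  rw [hx.periodic] at w2
  refine hno ⟨_, _, _, w1.append h1.symm w2, h2.symm, ?_, ?_, by omega⟩
  · refine (hx.nodup_arc (by omega)).append (List.nodup_reverse.2 (hx.nodup_arc (by omega))) ?_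
    rw [List.disjoint_reverse_right]
    exact hx.disjoint_arc (by omega) (by omega)
  · simp only [List.length_append, length_arc, List.length_reverse]
    omega

/-- For a cycle with `c ≥ 3 k - 1` vertices in a graph without `2 k`-cycle, the chords of the three
lengths `D`, `D + 2 k - 2` and `D + c - 2 k` fall into groups of three, any two of which would give
a `2 k`-cycle. -/
theorem chordCount_add_chordCount_add_chordCount_le :
    chordCount G c x D + chordCount G c x (D + (2 * k - 2)) + chordCount G c x (D + (c - 2 * k)) ≤
      c := by
  classical
  have h1 := hx.chordCount_shift D (k - 1)
  have h2 := hx.chordCount_shift (D + (2 * k - 2)) 0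
  have h3 := hx.chordCount_shift (D + (c - 2 * k)) k
  rw [← h1, ← h2, ← h3, ← Finset.sum_add_distrib, ← Finset.sum_add_distrib]
  calc _ ≤ ∑ i ∈ Finset.range c, 1 := Finset.sum_le_sum fun i _ => ?_
    _ = c := by simp
  have hx' := hx.shift i
  have n1 := not_adj_nested hx' hno hD hDk hkc hk
  have n2 := not_adj_crossing_left hx' hno hD hDk hkc hk
  have n3 := not_adj_crossing_right hx' hno hD hDk hkc hk
  simp only [add_zero] at n1 n2 n3
  rw [show i + (k - 1 + D) = i + (k - 1) + D by omega,
    show i + (D + 2 * k - 2) = i + 0 + (D + (2 * k - 2)) by omega] at n1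
  rw [show i + (k - 1 + D) = i + (k - 1) + D by omega,
    show i + (D + c - k) = i + k + (D + (c - 2 * k)) by omega] at n2
  rw [show i + (D + 2 * k - 2) = i + 0 + (D + (2 * k - 2)) by omega,
    show i + (D + c - k) = i + k + (D + (c - 2 * k)) by omega] at n3
  simp only [add_zero] at n1 n2 n3 ⊢
  split_ifs <;> first | omega | tauto

end

variable [Fintype V]

open Classical in
/-- A cycle missing exactly one vertex: the count of chords bounds the average number of neighbours
on the cycle by `k`, so the missing vertex has to be adjacent to the whole cycle. -/
theorem IsCyclicParam.hasCycle_of_missing_one (hx : IsCyclicParam G (3 * k - 1) x) (hk : 2 ≤ k)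
    (hV : Fintype.card V = 3 * k) (hd : ∀ v, k + 1 ≤ G.degree v) : HasCycle G (2 * k) := by
  by_contra hno
  have hcard := hx.card_outside
  obtain ⟨r, hr⟩ := Finset.card_eq_one.1 (show ((Finset.univ : Finset V).filter
    fun r => r ∉ Set.range x).card = 1 by omega)
  have hr' : ∀ v, v ∉ Set.range x ↔ v = r := fun v => by
    simpa using congrArg (v ∈ ·) hr
  have hrx : r ∉ Set.range x := (hr' r).2 rfl
  set e := chordCount G (3 * k - 1) x with he
  have htriple : ∑ D ∈ Finset.Ico 1 (k + 1), (e D + e (D + (2 * k - 2)) + e (D + (k - 1))) ≤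
      k * (3 * k - 1) := by
    calc _ ≤ ∑ D ∈ Finset.Ico 1 (k + 1), (3 * k - 1) := Finset.sum_le_sum fun D hD => ?_
      _ = k * (3 * k - 1) := by simp
    rw [Finset.mem_Ico] at hD
    have := chordCount_add_chordCount_add_chordCount_le hx hno hD.1 (by omega) (by omega) hk
    rwa [show 3 * k - 1 - 2 * k = k - 1 by omega] at this
  -- The three families of lengths with `1 ≤ D ≤ k` cover all lengths from `1` to `3 k - 2`.
  have htotal : ∑ D ∈ Finset.Ico 1 (3 * k - 1), e D ≤ k * (3 * k - 1) := by
    refine le_trans ?_ htriple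
    rw [Finset.sum_add_distrib, Finset.sum_add_distrib, Finset.sum_Ico_add', Finset.sum_Ico_add',
      ← Finset.sum_Ico_consecutive e (show 1 ≤ k by omega) (show k ≤ 3 * k - 1 by omega),
      ← Finset.sum_Ico_consecutive e (show k ≤ 2 * k by omega) (show 2 * k ≤ 3 * k - 1 by omega)]
    have m1 : ∑ D ∈ Finset.Ico 1 k, e D ≤ ∑ D ∈ Finset.Ico 1 (k + 1), e D :=
      Finset.sum_le_sum_of_subset (Finset.Ico_subset_Ico_right (by omega))
    have m2 : ∑ D ∈ Finset.Ico (2 * k) (3 * k - 1), e D ≤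
        ∑ D ∈ Finset.Ico (1 + (2 * k - 2)) (k + 1 + (2 * k - 2)), e D :=
      Finset.sum_le_sum_of_subset (Finset.Ico_subset_Ico (by omega) (by omega))
    have m3 : ∑ D ∈ Finset.Ico k (2 * k), e D ≤
        ∑ D ∈ Finset.Ico (1 + (k - 1)) (k + 1 + (k - 1)), e D :=
      Finset.sum_le_sum_of_subset (Finset.Ico_subset_Ico (by omega) (by omega))
    omega
  rw [hx.sum_chordCount] at htotal
  have hlow : (3 * k - 1) * (k + 1) ≤ ∑ i ∈ Finset.range (3 * k - 1),
      (((Finset.range (3 * k - 1)).filter fun m => G.Adj (x i) (x m)).card +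
        if G.Adj (x i) r then 1 else 0) := by
    calc (3 * k - 1) * (k + 1) = ∑ i ∈ Finset.range (3 * k - 1), (k + 1) := by simp
      _ ≤ _ := Finset.sum_le_sum fun i _ => ?_
    refine (hd (x i)).trans ((hx.degree_eq (x i)).le.trans ?_)
    refine Nat.add_le_add_left ?_ _
    simp only [hr']
    split_ifs with h
    · refine Finset.card_le_one.2 ?_
      intro a ha b hb
      simp only [Finset.mem_filter, Finset.mem_univ, true_and] at ha hb
      rw [ha.2, hb.2]
    · rw [Nat.le_zero, Finset.card_eq_zero]
      ext a
      simp only [Finset.mem_filter, Finset.mem_univ, true_and, Finset.notMem_empty, iff_false]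
      rintro ⟨h1, rfl⟩
      exact h h1
  rw [Finset.sum_add_distrib, ← Finset.card_filter] at hlow
  have hall : ((Finset.range (3 * k - 1)).filter fun i => G.Adj (x i) r) =
      Finset.range (3 * k - 1) := by
    refine Finset.eq_of_subset_of_card_le (Finset.filter_subset _ _) ?_
    rw [Finset.card_range]
    have : (3 * k - 1) * (k + 1) = k * (3 * k - 1) + (3 * k - 1) := by ring
    omega
  have hadj : ∀ i < 3 * k - 1, G.Adj (x i) r := fun i hi => by
    have : i ∈ (Finset.range (3 * k - 1)).filter fun i => G.Adj (x i) r := by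
      rw [hall]
      simpa using hi
    exact (Finset.mem_filter.1 this).2
  -- The vertex `r` closes an arc with `2 k - 1` vertices to a cycle.
  refine hno ⟨_, _, _, (hx.isWalkList_arc (Nat.zero_le (2 * k - 2))).append
    (hadj _ (by omega)) (IsWalkList.single r), (hadj 0 (by omega)).symm, ?_, ?_, by omega⟩
  · refine (hx.nodup_arc (by omega)).append (List.nodup_singleton r) ?_
    exact disjoint_of_forall_notMem_range (by simpa using hrx)
  · simp only [List.length_append, length_arc, List.length_singleton]
    omega

open Classical in
/-- A Hamiltonian cycle: the count of chords leaves only the extremal case, in which some chord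
bypasses exactly one vertex. -/
theorem IsCyclicParam.hasCycle_of_hamiltonian (hx : IsCyclicParam G (3 * k) x) (hk : 2 ≤ k)
    (hV : Fintype.card V = 3 * k) (hd : ∀ v, k + 1 ≤ G.degree v) : HasCycle G (2 * k) := by
  by_contra hno
  have hcard := hx.card_outside
  have hout : ((Finset.univ : Finset V).filter fun r => r ∉ Set.range x) = ∅ :=
    Finset.card_eq_zero.1 (by omega)
  set e := chordCount G (3 * k) x with he
  have htri : ∀ D ∈ Finset.Ico 1 (k + 1), e D + e (D + (2 * k - 2)) + e (D + k) ≤ 3 * k := by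
    intro D hD
    rw [Finset.mem_Ico] at hD
    have := chordCount_add_chordCount_add_chordCount_le hx hno hD.1 (by omega) (by omega) hk
    rwa [show 3 * k - 2 * k = k by omega] at this
  have e2k1 : e (2 * k - 1) = 0 := hx.chordCount_two_mul_sub_one hk (by omega) hno
  have htotal : 3 * k * (k + 1) ≤ ∑ D ∈ Finset.Ico 1 (3 * k), e D := by
    rw [hx.sum_chordCount]
    calc 3 * k * (k + 1) = ∑ i ∈ Finset.range (3 * k), (k + 1) := by simp
      _ ≤ _ := Finset.sum_le_sum fun i _ => ?_
    refine (hd (x i)).trans ((hx.degree_eq (x i)).le.trans ?_)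
    rw [show ((Finset.univ : Finset V).filter fun r => G.Adj (x i) r ∧ r ∉ Set.range x) = ∅ from ?_]
    · simp
    · rw [← Finset.subset_empty, ← hout]
      exact fun r hr => by simpa using (Finset.mem_filter.1 hr).2.2
  -- The three families of lengths overlap in `2 k - 1` and `2 k` and leave out only `3 k - 1`.
  have hsum : ∑ D ∈ Finset.Ico 1 (k + 1), (e D + e (D + (2 * k - 2)) + e (D + k)) + e (3 * k - 1) =
      ∑ D ∈ Finset.Ico 1 (3 * k), e D + e (2 * k - 1) + e (2 * k) := by
    rw [Finset.sum_add_distrib, Finset.sum_add_distrib, Finset.sum_Ico_add', Finset.sum_Ico_add',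
      ← Finset.sum_Ico_consecutive e (show 1 ≤ k + 1 by omega) (show k + 1 ≤ 3 * k by omega),
      ← Finset.sum_Ico_consecutive e (show k + 1 ≤ 2 * k + 1 by omega)
        (show 2 * k + 1 ≤ 3 * k by omega),
      show 1 + (2 * k - 2) = 2 * k - 1 by omega, show k + 1 + (2 * k - 2) = 3 * k - 1 by omega,
      show 1 + k = k + 1 by omega, show k + 1 + k = 2 * k + 1 by omega]
    have m1 := Finset.sum_eq_sum_Ico_succ_bot (show 2 * k - 1 < 3 * k - 1 by omega) e
    have m2 := Finset.sum_eq_sum_Ico_succ_bot (show 2 * k - 1 + 1 < 3 * k by omega) e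
    have m3 := Finset.sum_Ico_succ_top (show 2 * k - 1 + 1 ≤ 3 * k - 1 by omega) e
    rw [show 3 * k - 1 + 1 = 3 * k by omega] at m3
    rw [show 2 * k - 1 + 1 = 2 * k by omega] at m1 m2 m3
    omega
  have hle : e (3 * k - 1) ≤ 3 * k := chordCount_le _
  have hmul : 3 * k * (k + 1) = k * (3 * k) + 3 * k := by ring
  have hconst : ∑ D ∈ Finset.Ico 1 (k + 1), 3 * k = k * (3 * k) := by simp
  -- The lower bound for the degrees forces equality in `htri`, and `e (2 * k) = 0`.
  have hk' : e k + e (k + (2 * k - 2)) + e (k + k) = 3 * k := by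
    by_contra hne
    have hmem : k ∈ Finset.Ico 1 (k + 1) := by simp; omega
    have := Finset.sum_lt_sum htri ⟨k, hmem, lt_of_le_of_ne (htri k hmem) hne⟩
    omega
  have hle2 := Finset.sum_le_sum htri
  have e2k : e (2 * k) = 0 := by omega
  have ek : e k = 0 := by
    have := hx.chordCount_symm (D := 2 * k) (by omega)
    rw [show 3 * k - 2 * k = k by omega] at this
    exact this.trans e2k
  have hpos : e (3 * k - 2) ≠ 0 := by
    rw [show k + (2 * k - 2) = 3 * k - 2 by omega, show k + k = 2 * k by omega] at hk'
    omega
  obtain ⟨i, -, hi⟩ := Finset.exists_ne_zero_of_sum_ne_zero hpos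
  have hadj : G.Adj (x i) (x (i + (3 * k - 2))) := by
    by_contra h
    exact hi (if_neg h)
  have hcyc : HasCycle G (3 * k - 1) := by
    refine ⟨_, _, arc x i (i + (3 * k - 2)), hx.isWalkList_arc (by omega), hadj.symm,
      hx.nodup_arc (by omega), ?_, by omega⟩
    rw [length_arc]
    omega
  obtain ⟨x', hx'⟩ := hcyc.exists_isCyclicParam
  exact hno (hx'.hasCycle_of_missing_one hk hV hd)

end Chords

/-! ### Cycles through an independent set -/

section Alternating

variable {V : Type*} {G : SimpleGraph V}

/-- The bipartite subgraph of the edges of `G` between `A` and `B`. -/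
def edgesBetween (G : SimpleGraph V) (A B : Finset V) : SimpleGraph V where
  Adj u v := G.Adj u v ∧ (u ∈ A ∧ v ∈ B ∨ u ∈ B ∧ v ∈ A)
  symm := ⟨fun _ _ h => ⟨h.1.symm, h.2.symm.imp And.symm And.symm⟩⟩
  loopless := ⟨fun _ h => h.1.ne rfl⟩

variable {A B : Finset V}

theorem edgesBetween_adj {a b : V} (ha : a ∈ A) (hb : b ∈ B) (h : G.Adj a b) :
    (edgesBetween G A B).Adj a b := ⟨h, Or.inl ⟨ha, hb⟩⟩

open Classical in
/-- A form of a theorem of Jackson: if each of the `k` vertices of `A` has at least `k + 1`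
neighbours in a set `B` with at most `2 k - 2` vertices, then there is a cycle alternating between
`A` and `B` through all of `A`. -/
theorem hasCycle_of_card_neighbors_between [Fintype V] {k : ℕ} (hk : 2 ≤ k) (hAB : Disjoint A B)
    (hA : A.card = k) (hB : B.card + 2 ≤ 2 * k)
    (hd : ∀ a ∈ A, k + 1 ≤ (B.filter fun b => G.Adj a b).card) : HasCycle G (2 * k) := by
  set F := edgesBetween G A B with hF
  have hAB' : ∀ v, v ∈ A → v ∉ B := fun v hv => Finset.disjoint_left.1 hAB hv
  have hFG : F ≤ G := fun u v h => h.1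
  have hFA : ∀ u v, F.Adj u v → u ∈ A → v ∈ B := fun u v h hu =>
    h.2.elim And.right fun h' => absurd h'.1 (hAB' u hu)
  have hFB : ∀ u v, F.Adj u v → u ∈ B → v ∈ A := fun u v h hu =>
    h.2.elim (fun h' => absurd hu (hAB' u h'.1)) And.right
  -- There is an alternating cycle, with four vertices.
  have hfour : HasCycle F 4 := by
    obtain ⟨a, ha, a', ha', hne⟩ := Finset.one_lt_card.1 (show 1 < A.card by omega)
    have h1 := hd a ha
    have h2 := hd a' ha'
    have h3 := Finset.card_union_add_card_inter (B.filter fun b => G.Adj a b)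
      (B.filter fun b => G.Adj a' b)
    have h4 := Finset.card_le_card (Finset.union_subset (Finset.filter_subset (fun b => G.Adj a b) B)
      (Finset.filter_subset (fun b => G.Adj a' b) B))
    obtain ⟨b, hb, b', hb', hbne⟩ := Finset.one_lt_card.1 (show 1 <
      ((B.filter fun b => G.Adj a b) ∩ (B.filter fun b => G.Adj a' b)).card by omega)
    simp only [Finset.mem_inter, Finset.mem_filter] at hb hb'
    refine ⟨_, _, _, (((IsWalkList.single a).append (edgesBetween_adj ha hb.1.1 hb.1.2)
      (IsWalkList.single b)).append (edgesBetween_adj ha' hb.1.1 hb.2.2).symm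
      (IsWalkList.single a')).append (edgesBetween_adj ha' hb'.1.1 hb'.2.2) (IsWalkList.single b'),
      (edgesBetween_adj ha hb'.1.1 hb'.1.2).symm, ?_, rfl, by norm_num⟩
    have n1 : ∀ u ∈ A, ∀ v ∈ B, u ≠ v := fun u hu v hv h => hAB' u hu (h ▸ hv)
    simp [hne, hbne, n1 a ha b hb.1.1, n1 a ha b' hb'.1.1, (n1 a' ha' b hb.1.1).symm,
      n1 a' ha' b' hb'.1.1]
  -- A longest alternating cycle is considered; it has `2 m` vertices with `m ≤ k`.
  obtain ⟨c, hc, hmax⟩ : ∃ c, HasCycle F c ∧ ∀ m, HasCycle F m → m ≤ c :=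
    ⟨Nat.findGreatest (HasCycle F) (Fintype.card V), Nat.findGreatest_spec hfour.le_card hfour,
      fun m hm => Nat.le_findGreatest hm.le_card hm⟩
  obtain ⟨x, hx, hx0⟩ : ∃ x, IsCyclicParam F c x ∧ x 0 ∈ A := by
    obtain ⟨x, hx⟩ := hc.exists_isCyclicParam
    rcases (hx.adj 0).2 with h | h
    · exact ⟨x, hx, h.1⟩
    · exact ⟨_, hx.shift 1, h.2⟩
  have heven : ∀ i, x (2 * i) ∈ A := by
    intro i
    induction i with
    | zero => exact hx0
    | succ i ih => exact hFB _ _ (hx.adj (2 * i + 1)) (hFA _ _ (hx.adj (2 * i)) ih)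
  have hodd : ∀ i, x (2 * i + 1) ∈ B := fun i => hFA _ _ (hx.adj (2 * i)) (heven i)
  obtain ⟨m, rfl⟩ : ∃ m, c = 2 * m := by
    rcases Nat.even_or_odd' c with ⟨m, h | h⟩
    · exact ⟨m, h⟩
    · refine absurd (hodd m) (hAB' _ ?_)
      rw [← h, ← zero_add c, hx.periodic]
      exact hx0
  have hm2 : 2 ≤ m := by
    have := hmax 4 hfour
    omega
  have hinjA : ((Finset.range m).image fun i => x (2 * i)).card = m := by
    rw [Finset.card_image_of_injOn, Finset.card_range]
    intro i hi j hj e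
    simp only [Finset.coe_range, Set.mem_Iio] at hi hj
    have := hx.injOn _ (by omega) _ (by omega) e
    omega
  have hinjB : ((Finset.range m).image fun i => x (2 * i + 1)).card = m := by
    rw [Finset.card_image_of_injOn, Finset.card_range]
    intro i hi j hj e
    simp only [Finset.coe_range, Set.mem_Iio] at hi hj
    have := hx.injOn _ (by omega) _ (by omega) e
    omega
  have hsubA : ((Finset.range m).image fun i => x (2 * i)) ⊆ A := by
    intro v hv
    obtain ⟨i, -, rfl⟩ := Finset.mem_image.1 hv
    exact heven i
  have hmk := Finset.card_le_card hsubA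
  rw [hinjA, hA] at hmk
  rcases hmk.eq_or_lt with rfl | hmk
  · exact hx.hasCycle.mono hFG
  exfalso
  -- For `m < k`, some vertex `a₀` of `A` is off the cycle.
  obtain ⟨a₀, ha₀, ha₀'⟩ : ∃ a ∈ A, a ∉ (Finset.range m).image fun i => x (2 * i) := by
    by_contra h
    push Not at h
    have := Finset.card_le_card (show A ⊆ _ from h)
    omega
  have hmem : ∀ v ∈ Set.range x, (∃ i < m, x (2 * i) = v) ∨ ∃ i < m, x (2 * i + 1) = v := by
    intro v hv
    obtain ⟨i, hi, rfl⟩ := hx.exists_eq_of_mem_range hv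
    rcases Nat.even_or_odd' i with ⟨j, rfl | rfl⟩
    · exact Or.inl ⟨j, by omega, rfl⟩
    · exact Or.inr ⟨j, by omega, rfl⟩
  have ha₀x : a₀ ∉ Set.range x := by
    intro h
    rcases hmem a₀ h with ⟨i, hi, e⟩ | ⟨i, hi, e⟩
    · exact ha₀' (Finset.mem_image.2 ⟨i, by simpa using hi, e⟩)
    · exact hAB' a₀ ha₀ (e ▸ hodd i)
  set B' := B \ (Finset.range m).image fun i => x (2 * i + 1) with hB'
  have hB'card : B'.card + m = B.card := by
    have := Finset.card_sdiff_add_card_eq_card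
      (show ((Finset.range m).image fun i => x (2 * i + 1)) ⊆ B by
        intro v hv
        obtain ⟨i, -, rfl⟩ := Finset.mem_image.1 hv
        exact hodd i)
    rw [hinjB] at this
    exact this
  have hB'mem : ∀ v ∈ B', v ∈ B ∧ v ∉ Set.range x := by
    intro v hv
    obtain ⟨h1, h2⟩ := Finset.mem_sdiff.1 hv
    refine ⟨h1, fun h => ?_⟩
    rcases hmem v h with ⟨i, hi, rfl⟩ | ⟨i, hi, e⟩
    · exact hAB' _ (heven i) h1
    · exact h2 (Finset.mem_image.2 ⟨i, by simpa using hi, e⟩)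
  let N : V → Finset V := fun a => B'.filter fun b => G.Adj a b
  have hNmem : ∀ a b, b ∈ N a → b ∈ B' ∧ G.Adj a b := fun a b h => Finset.mem_filter.1 h
  have hNsub : ∀ a, N a ⊆ B' := fun a => Finset.filter_subset _ _
  have hsplit : ∀ a ∈ A, k + 1 ≤ (N a).card +
      ((Finset.range m).filter fun i => G.Adj a (x (2 * i + 1))).card := by
    intro a ha
    refine (hd a ha).trans ?_
    have hsub : (B.filter fun b => G.Adj a b) ⊆
        N a ∪ ((Finset.range m).filter fun i => G.Adj a (x (2 * i + 1))).image
          fun i => x (2 * i + 1) := by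
      intro b hb
      obtain ⟨hb1, hb2⟩ := Finset.mem_filter.1 hb
      rw [Finset.mem_union]
      by_cases h : b ∈ (Finset.range m).image fun i => x (2 * i + 1)
      · obtain ⟨i, hi, rfl⟩ := Finset.mem_image.1 h
        exact Or.inr (Finset.mem_image.2 ⟨i, Finset.mem_filter.2 ⟨hi, hb2⟩, rfl⟩)
      · exact Or.inl (Finset.mem_filter.2 ⟨Finset.mem_sdiff.2 ⟨hb1, h⟩, hb2⟩)
    exact (Finset.card_le_card hsub).trans ((Finset.card_union_le _ _).trans
      (Nat.add_le_add_left Finset.card_image_le _))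
  have hNlow : ∀ a ∈ A, k + 1 ≤ (N a).card + m := by
    intro a ha
    refine (hsplit a ha).trans (Nat.add_le_add_left ?_ _)
    exact (Finset.card_filter_le _ _).trans (by simp)
  set T := (Finset.range m).filter fun i => G.Adj a₀ (x (2 * i + 1)) with hT
  have hTmem : ∀ i ∈ T, i < m ∧ F.Adj a₀ (x (2 * i + 1)) := by
    intro i hi
    obtain ⟨h1, h2⟩ := Finset.mem_filter.1 hi
    exact ⟨by simpa using h1, edgesBetween_adj ha₀ (hodd i) h2⟩
  have hT₀ : k + 1 ≤ (N a₀).card + T.card := hsplit a₀ ha₀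
  have hNF : ∀ a ∈ A, ∀ b ∈ N a, F.Adj a b := fun a ha b hb =>
    edgesBetween_adj ha (hB'mem b (hNmem a b hb).1).1 (hNmem a b hb).2
  rcases T.eq_empty_or_nonempty with hTe | hTne
  · -- If `a₀` has no neighbour on the cycle, then it can replace the vertex `x 1`, together with two
    -- vertices of `B` off the cycle.
    rw [hTe, Finset.card_empty] at hT₀
    have hcommon : ∀ a ∈ A, 1 < (N a ∩ N a₀).card := by
      intro a ha
      have h1 := Finset.card_union_add_card_inter (N a) (N a₀)
      have h2 := Finset.card_le_card (Finset.union_subset (hNsub a) (hNsub a₀))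
      have h3 := hNlow a ha
      omega
    obtain ⟨b, hb⟩ := Finset.card_pos.1 (zero_lt_one.trans (hcommon _ (heven 0)))
    obtain ⟨b', hb', hbb'⟩ := Finset.exists_mem_ne (hcommon _ (heven 1)) b
    rw [Finset.mem_inter] at hb hb'
    have w := hx.isWalkList_arc (show 2 ≤ 0 + 2 * m by omega)
    rw [hx.periodic] at w
    have hlen := hmax _ ⟨_, _, _, ((w.append (hNF _ (heven 0) b hb.1) (IsWalkList.single b)).append
      (hNF _ ha₀ b hb.2).symm (IsWalkList.single a₀)).append (hNF _ ha₀ b' hb'.2)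
      (IsWalkList.single b'), (hNF _ (heven 1) b' hb'.1).symm, ?_, rfl, ?_⟩
    · simp only [List.length_append, length_arc, List.length_singleton] at hlen
      omega
    · have n1 := (hB'mem b (hNmem _ _ hb.1).1)
      have n2 := (hB'mem b' (hNmem _ _ hb'.1).1)
      have n3 : ∀ v ∈ B, v ≠ a₀ := fun v hv h => hAB' a₀ ha₀ (h ▸ hv)
      rw [List.append_assoc, List.append_assoc]
      refine (hx.nodup_arc (by omega)).append ?_ (disjoint_of_forall_notMem_range ?_)
      · simp [n3 b n1.1, (n3 b' n2.1).symm, hbb'.symm]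
      · simp only [List.cons_append, List.nil_append, List.mem_cons, List.not_mem_nil, or_false]
        rintro v (rfl | rfl | rfl)
        · exact n1.2
        · exact ha₀x
        · exact n2.2
    · simp only [List.length_append, length_arc, List.length_singleton]
      omega
  · -- Otherwise, the neighbourhoods off the cycle of `a₀` and of the successors of its neighbours on
    -- the cycle are disjoint, and too large for `B`.
    have hdisj₀ : ∀ i ∈ T, Disjoint (N (x (2 * (i + 1)))) (N a₀) := by
      intro i hi
      rw [Finset.disjoint_left]
      intro b hb hb₀
      have hb' := hB'mem b (hNmem _ _ hb).1
      refine not_adj_of_adj_succ hx hmax (P := [a₀] ++ [b])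
        ((IsWalkList.single a₀).append (hNF _ ha₀ b hb₀) (IsWalkList.single b)) ?_ ?_
        (hTmem i hi).2.symm (hNF _ (heven (i + 1)) b hb).symm
      · have : a₀ ≠ b := fun h => hAB' a₀ ha₀ (h ▸ hb'.1)
        simpa using this
      · simpa using And.intro (by simpa using ha₀x) (by simpa using hb'.2)
    have hdisj : ∀ i ∈ T, ∀ j ∈ T, i < j → Disjoint (N (x (2 * (i + 1)))) (N (x (2 * (j + 1)))) := by
      intro i hi j hj hij
      rw [Finset.disjoint_left]
      intro b hb hbj
      have hjm := (hTmem j hj).1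
      have hb' := hB'mem b (hNmem _ _ hb).1
      have hr := hx.range_shift (2 * (j + 1))
      refine not_adj_and_adj_outside (hx.shift (2 * (j + 1))) hmax (IsWalkList.single a₀)
        (List.nodup_singleton a₀) ?_ (i := 2 * i + 1 + 2 * m - 2 * (j + 1)) (by omega) ?_ ?_
        (r := b) ?_ ?_ ⟨?_, hNF _ (heven (j + 1)) b hbj⟩
      · rw [hr]
        simpa using ha₀x
      · rw [show 2 * (j + 1) + (2 * i + 1 + 2 * m - 2 * (j + 1)) = 2 * i + 1 + 2 * m by omega,
          hx.periodic]
        exact (hTmem i hi).2.symm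
      · rw [show 2 * (j + 1) + (2 * m - 1) = 2 * j + 1 + 2 * m by omega, hx.periodic]
        exact (hTmem j hj).2
      · rw [hr]
        exact hb'.2
      · rw [List.mem_singleton]
        rintro rfl
        exact hAB' b ha₀ hb'.1
      · rw [show 2 * (j + 1) + (2 * i + 1 + 2 * m - 2 * (j + 1) + 1) = 2 * (i + 1) + 2 * m by omega,
          hx.periodic]
        exact hNF _ (heven (i + 1)) b hb
    have hbi : (T.biUnion fun i => N (x (2 * (i + 1)))).card =
        ∑ i ∈ T, (N (x (2 * (i + 1)))).card := by
      refine Finset.card_biUnion ?_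
      intro i hi j hj hij
      rcases lt_or_gt_of_ne hij with h | h
      · exact hdisj i hi j hj h
      · exact (hdisj j hj i hi h).symm
    have hsum : T.card * (k + 1 - m) ≤ ∑ i ∈ T, (N (x (2 * (i + 1)))).card := by
      rw [← smul_eq_mul]
      refine Finset.card_nsmul_le_sum _ _ _ fun i _ => ?_
      have := hNlow _ (heven (i + 1))
      omega
    have hle : (T.biUnion fun i => N (x (2 * (i + 1)))).card + (N a₀).card ≤ B'.card := by
      rw [← Finset.card_union_of_disjoint]
      · exact Finset.card_le_card (Finset.union_subset
          (Finset.biUnion_subset.2 fun i _ => hNsub _) (hNsub a₀))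
      · rw [Finset.disjoint_biUnion_left]
        exact hdisj₀
    have hTpos := hTne.card_pos
    have hmul : T.card + (k - m) ≤ T.card * (k + 1 - m) := by
      obtain ⟨t, ht⟩ : ∃ t, T.card = t + 1 := ⟨T.card - 1, by omega⟩
      obtain ⟨s, hs⟩ : ∃ s, k = m + s := ⟨k - m, by omega⟩
      rw [ht, hs, show m + s + 1 - m = s + 1 by omega, show m + s - m = s by omega]
      nlinarith [Nat.zero_le (t * s)]
    omega

end Alternating

/-! ### Cycles with two thirds of the vertices -/

section TwoThirds

open Classical in
/-- A graph on `3 k` vertices without cut vertex and with minimum degree at least `k + 1` contains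
a cycle with exactly `2 k` vertices. -/
theorem hasCycle_two_mul {V : Type*} [Fintype V] {G : SimpleGraph V} {k : ℕ} (hk : 2 ≤ k)
    (hV : Fintype.card V = 3 * k) (hd : ∀ v, k + 1 ≤ G.degree v) (hcut : NoCutVertex G) :
    HasCycle G (2 * k) := by
  have : Nonempty V := Fintype.card_pos_iff.1 (by omega)
  obtain ⟨m, hm⟩ := exists_hasCycle_of_two_le_degree fun v => (show 2 ≤ k + 1 by omega).trans (hd v)
  obtain ⟨c, hc, hmax⟩ : ∃ c, HasCycle G c ∧ ∀ m, HasCycle G m → m ≤ c :=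
    ⟨Nat.findGreatest (HasCycle G) (Fintype.card V), Nat.findGreatest_spec hm.le_card hm,
      fun m hm => Nat.le_findGreatest hm.le_card hm⟩
  obtain ⟨x, hx⟩ := hc.exists_isCyclicParam
  by_cases hall : ∀ y, y ∈ Set.range x
  · have hcard := hx.card_outside
    rw [Finset.filter_false_of_mem (by simpa using hall), Finset.card_empty] at hcard
    obtain rfl : c = 3 * k := by omega
    exact hx.hasCycle_of_hamiltonian hk hV hd
  · push Not at hall
    obtain ⟨y, hy⟩ := hall
    obtain ⟨I, hI, hind⟩ := exists_isIndepSet_of_longest_cycle hx hmax (hd y) hy fun r hr =>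
      not_adj_of_notMem_longest_cycle hx hmax hcut hd (by omega) hy hr
    obtain ⟨A, hAI, hA⟩ := Finset.exists_subset_card_eq (show k ≤ I.card by omega)
    refine hasCycle_of_card_neighbors_between hk (A := A) (B := Iᶜ)
      (Finset.disjoint_left.2 fun a ha ha' => Finset.mem_compl.1 ha' (hAI ha)) hA ?_ ?_
    · rw [Finset.card_compl]
      omega
    · intro a ha
      refine (hd a).trans ?_
      rw [← G.card_neighborFinset_eq_degree]
      refine Finset.card_le_card fun b hb => ?_
      have hb' : G.Adj a b := by simpa using hb
      exact Finset.mem_filter.2 ⟨Finset.mem_compl.2 fun h => hind a (hAI ha) b h hb', hb'⟩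

end TwoThirds

/-! ### Wheels in graphs of large minimum degree -/

section Wheels

variable {V : Type*} {G : SimpleGraph V}

/-- The subgraph of the edges of `G` inside the neighbourhood of `u`, on the vertex set of `G`. -/
def linkGraph (G : SimpleGraph V) (u : V) : SimpleGraph V where
  Adj a b := G.Adj a b ∧ G.Adj u a ∧ G.Adj u b
  symm := ⟨fun _ _ h => ⟨h.1.symm, h.2.2, h.2.1⟩⟩
  loopless := ⟨fun _ h => h.1.ne rfl⟩

/-- `G` contains a hub `u` and a cycle with `m` vertices in the neighbourhood of `u`. -/
def HasWheel (G : SimpleGraph V) (m : ℕ) : Prop := ∃ u, HasCycle (linkGraph G u) m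

open Classical in
/-- If every vertex of `S` has at most `s` nonneighbours in `S`, then `S` contains paths with up to
`|S| - s` vertices. -/
theorem exists_isWalkList_of_nonneighbors_le {S : Finset V} {s : ℕ}
    (h : ∀ a ∈ S, (S.filter fun v => v ≠ a ∧ ¬ G.Adj a v).card ≤ s) (n : ℕ)
    (hn : n + 1 + s ≤ S.card) :
    ∃ a b l, IsWalkList G a l b ∧ l.Nodup ∧ l.length = n + 1 ∧ ∀ v ∈ l, v ∈ S := by
  induction n with
  | zero =>
    obtain ⟨a, ha⟩ := Finset.card_pos.1 (by omega : 0 < S.card)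
    exact ⟨a, a, [a], IsWalkList.single a, List.nodup_singleton a, rfl, by simpa using ha⟩
  | succ n ih =>
    obtain ⟨a, b, l, hw, hl, hlen, hS⟩ := ih (by omega)
    obtain ⟨v, hv, hv'⟩ : ∃ v ∈ S, v ∉ l.toFinset ∪ S.filter fun v => v ≠ b ∧ ¬ G.Adj b v := by
      by_contra hno
      push Not at hno
      have h1 := Finset.card_le_card (show S ⊆ _ from hno)
      have h2 := Finset.card_union_le l.toFinset (S.filter fun v => v ≠ b ∧ ¬ G.Adj b v)
      have h3 := h b (hS b hw.right_mem)
      rw [List.toFinset_card_of_nodup hl] at h2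
      omega
    simp only [Finset.mem_union, List.mem_toFinset, Finset.mem_filter, not_or, not_and,
      not_not] at hv'
    have hvb : v ≠ b := fun e => hv'.1 (e ▸ hw.right_mem)
    refine ⟨a, v, l ++ [v], hw.append (hv'.2 hv hvb) (IsWalkList.single v),
      hl.append (List.nodup_singleton v) (by simpa using hv'.1), by simp [hlen], ?_⟩
    intro w hw'
    rcases List.mem_append.1 hw' with h' | h'
    · exact hS w h'
    · rw [List.mem_singleton] at h'
      exact h' ▸ hv

open Classical in
/-- If any two vertices of `A` have at least `K` common neighbours in `Z`, then the vertices of a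
list in `A` can be linked to each other and to given vertices `e`, `f` of `A` through distinct
vertices of `Z`. -/
theorem exists_isWalkList_alternating {A Z : Finset V} {K : ℕ} (hAZ : Disjoint A Z)
    (hK : ∀ a ∈ A, ∀ a' ∈ A, K ≤ (Z.filter fun z => G.Adj a z ∧ G.Adj a' z).card) {f : V}
    (hf : f ∈ A) (q : List V) : ∀ (e : V) (used : Finset V), e ∈ A → q.Nodup → (∀ v ∈ q, v ∈ A) →
      used.card + q.length + 1 ≤ K → ∃ a b r, IsWalkList G a r b ∧ G.Adj e a ∧ G.Adj b f ∧
        r.length = 2 * q.length + 1 ∧ r.Nodup ∧ ∀ v ∈ r, v ∈ q ∨ v ∈ Z ∧ v ∉ used := by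
  have hex : ∀ e ∈ A, ∀ e' ∈ A, ∀ used : Finset V, used.card + 1 ≤ K →
      ∃ z ∈ Z, z ∉ used ∧ G.Adj e z ∧ G.Adj z e' := by
    intro e he e' he' used hu
    obtain ⟨z, hz, hz'⟩ := Finset.exists_mem_notMem_of_card_lt_card
      (show used.card < _ from lt_of_lt_of_le (by omega) (hK e he e' he'))
    obtain ⟨h1, h2, h3⟩ := Finset.mem_filter.1 hz
    exact ⟨z, h1, hz', h2, h3.symm⟩
  induction q with
  | nil =>
    intro e used he _ _ hu
    obtain ⟨z, hz, hzu, h1, h2⟩ := hex e he f hf used (by simpa using hu)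
    refine ⟨z, z, [z], IsWalkList.single z, h1, h2, rfl, List.nodup_singleton z, ?_⟩
    intro w hw
    rw [List.mem_singleton] at hw
    exact Or.inr (hw ▸ ⟨hz, hzu⟩)
  | cons v q ih =>
    intro e used he hq hqA hu
    rw [List.length_cons] at hu
    have hv : v ∈ A := hqA v (by simp)
    have hvZ : v ∉ Z := Finset.disjoint_left.1 hAZ hv
    obtain ⟨z, hz, hzu, h1, h2⟩ := hex e he v hv used (by omega)
    obtain ⟨hvq, hq'⟩ := List.nodup_cons.1 hq
    obtain ⟨a, b, r, hr, ha, hb, hlen, hn, hmem⟩ := ih v (insert z used) hv hq'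
      (fun w hw => hqA w (by simp [hw])) (by rw [Finset.card_insert_of_notMem hzu]; omega)
    have hzr : z ∉ r := by
      intro h
      rcases hmem z h with h | h
      · exact Finset.disjoint_left.1 hAZ (hqA z (by simp [h])) hz
      · exact h.2 (Finset.mem_insert_self z used)
    have hvr : v ∉ r := by
      intro h
      rcases hmem v h with h | h
      · exact hvq h
      · exact hvZ h.1
    have hzv : z ≠ v := fun h => hvZ (h ▸ hz)
    refine ⟨z, b, [z] ++ ([v] ++ r), (IsWalkList.single z).append h2
      ((IsWalkList.single v).append ha hr), h1, hb, ?_, ?_, ?_⟩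
    · simp only [List.length_append, List.length_cons, List.length_nil, hlen]
      omega
    · simp [hzr, hvr, hzv, hn]
    · intro w hw
      simp only [List.cons_append, List.nil_append, List.mem_cons] at hw
      rcases hw with rfl | rfl | hw
      · exact Or.inr ⟨hz, hzu⟩
      · exact Or.inl (by simp)
      · rcases hmem w hw with h | h
        · exact Or.inl (by simp [h])
        · exact Or.inr ⟨h.1, fun h' => h.2 (Finset.mem_insert_of_mem h')⟩

open Classical in
/-- Two sets `A` and `B` with `3 k - 1` vertices in total and no edge between them force a wheel.
The vertices of the smaller set `A` have so many nonneighbours in `B` that they are adjacent to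
almost all vertices outside `B`; the hub is a vertex of `A`, and the rim consists of a path in
`A` and of further vertices of `A` alternating with vertices outside `A ∪ B`. -/
theorem hasWheel_of_separated [Fintype V] {k : ℕ} (hV : Fintype.card V = 5 * k - 1) (hk : 2 ≤ k)
    (hd : ∀ v, 3 * k ≤ G.degree v) {A B : Finset V} (hA : A.Nonempty)
    (hAB : Disjoint A B) (hcard : A.card + B.card + 1 = 3 * k) (hle : A.card ≤ B.card)
    (hno : ∀ a ∈ A, ∀ b ∈ B, ¬ G.Adj a b) : HasWheel G (2 * k) := by
  obtain ⟨u, hu⟩ := hA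
  let nn : V → Finset V := fun a => (Bᶜ \ G.neighborFinset a).erase a
  have hnn : ∀ a ∈ A, (nn a).card + G.degree a + 1 + B.card = 5 * k - 1 := by
    intro a ha
    have haB : a ∈ Bᶜ \ G.neighborFinset a := by
      simpa using Finset.disjoint_left.1 hAB ha
    have hsub : G.neighborFinset a ⊆ Bᶜ := by
      intro v hv
      rw [Finset.mem_compl]
      exact fun h => hno a ha v h (by simpa using hv)
    have h1 := Finset.card_erase_add_one haB
    have h2 := Finset.card_sdiff_add_card_eq_card hsub
    have h3 := Finset.card_compl_add_card B
    rw [G.card_neighborFinset_eq_degree] at h2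
    simp only [nn]
    omega
  obtain ⟨s, hs⟩ : ∃ s, A.card = s + k + 1 := by
    have h1 := hnn u hu
    have h2 := hd u
    exact ⟨A.card - (k + 1), by omega⟩
  have hnns : ∀ a ∈ A, (nn a).card ≤ s := by
    intro a ha
    have h1 := hnn a ha
    have h2 := hd a
    omega
  set Au := A.filter fun v => G.Adj u v with hAu
  set Zu := (G.neighborFinset u).filter fun v => v ∉ A with hZu
  have hAuA : ∀ v ∈ Au, v ∈ A ∧ G.Adj u v := fun v hv => Finset.mem_filter.1 hv
  have hZuA : ∀ v ∈ Zu, G.Adj u v ∧ v ∉ A ∧ v ∉ B := fun v hv => by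
    obtain ⟨h1, h2⟩ := Finset.mem_filter.1 hv
    have h3 : G.Adj u v := by simpa using h1
    exact ⟨h3, h2, fun h => hno u hu v h h3⟩
  have hAZ : Disjoint Au Zu := Finset.disjoint_left.2 fun v h1 h2 => (hZuA v h2).2.1 (hAuA v h1).1
  have hAuZu : Au.card + Zu.card = G.degree u := by
    rw [← G.card_neighborFinset_eq_degree,
      ← Finset.card_filter_add_card_filter_not (s := G.neighborFinset u) (fun v => v ∈ A)]
    congr 2
    ext v
    simp [hAu, and_comm]
  have hAulow : k ≤ Au.card := by
    have hsub : A ⊆ insert u (Au ∪ nn u) := by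
      intro v hv
      rw [Finset.mem_insert, Finset.mem_union]
      by_cases h1 : v = u
      · exact Or.inl h1
      by_cases h2 : G.Adj u v
      · exact Or.inr (Or.inl (Finset.mem_filter.2 ⟨hv, h2⟩))
      · refine Or.inr (Or.inr ?_)
        simp only [nn, Finset.mem_erase, Finset.mem_sdiff, Finset.mem_compl,
          SimpleGraph.mem_neighborFinset]
        exact ⟨h1, Finset.disjoint_left.1 hAB hv, h2⟩
    have h1 := Finset.card_le_card hsub
    have h2 := Finset.card_insert_le u (Au ∪ nn u)
    have h3 := Finset.card_union_le Au (nn u)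
    have h4 := hnns u hu
    omega
  have hAuhigh : Au.card ≤ k + s := by
    have hsub : Au ⊆ A.erase u := by
      intro v hv
      exact Finset.mem_erase.2 ⟨(hAuA v hv).2.ne', (hAuA v hv).1⟩
    have h1 := Finset.card_le_card hsub
    have h2 := Finset.card_erase_add_one hu
    omega
  set F := linkGraph G u with hF
  -- The path uses `2 (|Au| - k) + 1` vertices, such that the remaining `2 k - 1 - |Au|` vertices of
  -- `Au`, alternating with `2 k - |Au|` vertices of `Zu`, complete a rim with `2 k` vertices.
  obtain ⟨p, p', l, hw, hl, hlen, hlA⟩ := exists_isWalkList_of_nonneighbors_le (G := F) (S := Au)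
    (s := s) (by
      intro a ha
      refine le_trans (Finset.card_le_card ?_) (hnns a (hAuA a ha).1)
      intro v hv
      obtain ⟨h1, h2, h3⟩ := Finset.mem_filter.1 hv
      simp only [nn, Finset.mem_erase, Finset.mem_sdiff, Finset.mem_compl,
          SimpleGraph.mem_neighborFinset]
      exact ⟨h2, Finset.disjoint_left.1 hAB (hAuA v h1).1,
        fun h => h3 ⟨h, (hAuA a ha).2, (hAuA v h1).2⟩⟩) (2 * (Au.card - k)) (by omega)
  have hK : ∀ a ∈ Au, ∀ a' ∈ Au,
      2 * k - Au.card ≤ (Zu.filter fun z => F.Adj a z ∧ F.Adj a' z).card := by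
    intro a ha a' ha'
    have hsub : Zu ⊆ (Zu.filter fun z => F.Adj a z ∧ F.Adj a' z) ∪ (nn a ∪ nn a') := by
      intro z hz
      obtain ⟨h1, h2, h3⟩ := hZuA z hz
      have hne : ∀ b ∈ Au, z ≠ b := fun b hb h => h2 (h ▸ (hAuA b hb).1)
      simp only [Finset.mem_union, Finset.mem_filter, nn, Finset.mem_erase, Finset.mem_sdiff,
        Finset.mem_compl, SimpleGraph.mem_neighborFinset]
      by_cases h4 : G.Adj a z
      · by_cases h5 : G.Adj a' z
        · exact Or.inl ⟨hz, ⟨h4, (hAuA a ha).2, h1⟩, ⟨h5, (hAuA a' ha').2, h1⟩⟩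
        · exact Or.inr (Or.inr ⟨hne a' ha', h3, h5⟩)
      · exact Or.inr (Or.inl ⟨hne a ha, h3, h4⟩)
    have h1 := Finset.card_le_card hsub
    have h2 := Finset.card_union_le (Zu.filter fun z => F.Adj a z ∧ F.Adj a' z) (nn a ∪ nn a')
    have h3 := Finset.card_union_le (nn a) (nn a')
    have h4 := hnns a (hAuA a ha).1
    have h5 := hnns a' (hAuA a' ha').1
    have h6 := hd u
    omega
  have hqcard : (Au \ l.toFinset).card + l.length = Au.card := by
    rw [← List.toFinset_card_of_nodup hl]
    exact Finset.card_sdiff_add_card_eq_card fun v hv => hlA v (List.mem_toFinset.1 hv)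
  obtain ⟨a, b, r, hr, ha, hb, hrlen, hrn, hrmem⟩ := exists_isWalkList_alternating hAZ hK
    (hlA p hw.left_mem) (Au \ l.toFinset).toList p' ∅ (hlA p' hw.right_mem)
    (Finset.nodup_toList _) (fun v hv => (Finset.mem_sdiff.1 (Finset.mem_toList.1 hv)).1) (by
      rw [Finset.card_empty, Finset.length_toList]
      omega)
  rw [Finset.length_toList] at hrlen
  refine ⟨u, p, b, l ++ r, hw.append ha hr, hb, hl.append hrn ?_, ?_, by omega⟩
  · rw [List.disjoint_left]
    intro v hv hvr
    rcases hrmem v hvr with h | h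
    · exact (Finset.mem_sdiff.1 (Finset.mem_toList.1 h)).2 (List.mem_toFinset.2 hv)
    · exact Finset.disjoint_left.1 hAZ (hlA v hv) h.1
  · rw [List.length_append]
    omega

open Classical in
/-- A graph on `5 k - 1` vertices with minimum degree at least `3 k` contains a wheel with a rim of
`2 k` vertices. -/
theorem hasWheel_of_degree_ge [Fintype V] {k : ℕ} (hV : Fintype.card V = 5 * k - 1) (hk : 2 ≤ k)
    (hd : ∀ v, 3 * k ≤ G.degree v) : HasWheel G (2 * k) := by
  by_contra hno
  have : Nonempty V := Fintype.card_pos_iff.1 (by omega)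
  let v : V := Classical.arbitrary V
  obtain ⟨S, hSv, hS⟩ := Finset.exists_subset_card_eq
    (show 3 * k ≤ (G.neighborFinset v).card by rw [G.card_neighborFinset_eq_degree]; exact hd v)
  have hSv' : ∀ w ∈ S, G.Adj v w := fun w hw => by simpa using hSv hw
  let H : SimpleGraph S := G.comap Subtype.val
  have hcyc : HasCycle H (2 * k) := by
    refine hasCycle_two_mul hk (by simpa using hS) ?_ ?_
    · rintro ⟨w, hw⟩
      have h1 : (S.filter fun z => G.Adj w z).card ≤ H.degree ⟨w, hw⟩ := by
        rw [← H.card_neighborFinset_eq_degree, ← Finset.card_map ⟨Subtype.val, Subtype.val_injective⟩]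
        refine Finset.card_le_card fun z hz => ?_
        obtain ⟨hz1, hz2⟩ := Finset.mem_filter.1 hz
        exact Finset.mem_map.2 ⟨⟨z, hz1⟩, by simpa [H] using hz2, rfl⟩
      have h2 : S ⊆ (S.filter fun z => G.Adj w z) ∪ (G.neighborFinset w)ᶜ := by
        intro z hz
        by_cases h : G.Adj w z <;> simp [hz, h]
      have h3 := Finset.card_le_card h2
      have h4 := Finset.card_union_le (S.filter fun z => G.Adj w z) (G.neighborFinset w)ᶜ
      have h5 := Finset.card_compl_add_card (G.neighborFinset w)
      rw [G.card_neighborFinset_eq_degree] at h5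
      have h6 := hd w
      have h7 : k + 1 ≤ H.degree ⟨w, hw⟩ := by omega
      convert h7
    · rintro w P hP hwP ⟨q, hqw, hqP⟩
      by_contra hcon
      push Not at hcon
      let ι : S ↪ V := ⟨Subtype.val, Subtype.val_injective⟩
      set Q : Finset S := (insert w P)ᶜ with hQ
      have hQne : Q.Nonempty := ⟨q, by simp [hQ, hqw, hqP]⟩
      have hPQ : Disjoint P Q := Finset.disjoint_left.2 fun p hp hp' => by
        simp [hQ, hp] at hp'
      have hcard : P.card + Q.card + 1 = 3 * k := by
        have h1 : Q.card + _ = _ := Finset.card_compl_add_card (insert w P)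
        rw [Finset.card_insert_of_notMem hwP, Fintype.card_coe, hS] at h1
        omega
      have hanti : ∀ p ∈ P, ∀ q ∈ Q, ¬ G.Adj p.1 q.1 := by
        intro p hp q hq
        simp only [hQ, Finset.mem_compl, Finset.mem_insert, not_or] at hq
        exact hcon p hp q hq.1 hq.2
      rcases le_total P.card Q.card with h | h
      · refine hno (hasWheel_of_separated hV hk hd (A := P.map ι) (B := Q.map ι) (hP.map)
          ((Finset.disjoint_map ι).2 hPQ) (by simpa using hcard) (by simpa using h) ?_)
        intro a ha b hb
        obtain ⟨p, hp, rfl⟩ := Finset.mem_map.1 ha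
        obtain ⟨q, hq, rfl⟩ := Finset.mem_map.1 hb
        exact hanti p hp q hq
      · refine hno (hasWheel_of_separated hV hk hd (A := Q.map ι) (B := P.map ι) (hQne.map)
          ((Finset.disjoint_map ι).2 hPQ.symm) (by simpa [add_comm] using hcard)
          (by simpa using h) ?_)
        intro a ha b hb
        obtain ⟨q, hq, rfl⟩ := Finset.mem_map.1 ha
        obtain ⟨p, hp, rfl⟩ := Finset.mem_map.1 hb
        exact fun h' => hanti p hp q hq h'.symm
  obtain ⟨x, hx⟩ := hcyc.exists_isCyclicParam
  refine hno ⟨v, IsCyclicParam.hasCycle (x := fun i => (x i).1) ⟨?_, ?_, ?_, hx.three_le⟩⟩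
  · exact fun i => ⟨hx.adj i, hSv' _ (x i).2, hSv' _ (x (i + 1)).2⟩
  · exact fun i => congrArg Subtype.val (hx.periodic i)
  · exact fun i hi j hj e => hx.injOn i hi j hj (Subtype.ext e)

end Wheels

/-! ### Wheels and stars as subgraphs -/

section Containment

variable {V : Type*} {G : SimpleGraph V}

theorem HasWheel.isContained {n : ℕ} (h : HasWheel G n) : (wheel n).IsContained G := by
  obtain ⟨u, hu⟩ := h
  obtain ⟨x, hx⟩ := hu.exists_isCyclicParam
  have h3 := hx.three_le
  have : NeZero n := ⟨by omega⟩
  have hux : ∀ i, G.Adj u (x i) := fun i => (hx.adj i).2.1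
  have step : ∀ i j : Fin n, (i - j).val = 1 → G.Adj (x j) (x i) := by
    intro i j hij
    have e : x i = x (j + 1) := by
      rw [← hx.apply_mod (j + 1), ← hij, ← Fin.val_add, add_sub_cancel]
    rw [e]
    exact (hx.adj j).1
  refine ⟨⟨⟨Sum.elim (fun i => x i) (fun _ => u), ?_⟩, ?_⟩⟩
  · rintro (i | i) (j | j) hij
    · have hij' : (SimpleGraph.cycleGraph n).Adj i j := by simpa [wheel, graphJoin] using hij
      rw [SimpleGraph.cycleGraph_adj'] at hij'
      exact hij'.elim (fun h => (step i j h).symm) (fun h => step j i h)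
    · exact (hux i).symm
    · exact hux j
    · simp [wheel, graphJoin, Subsingleton.elim i j] at hij
  · rintro (i | i) (j | j) hij
    · exact congrArg Sum.inl (Fin.ext (hx.injOn _ i.2 _ j.2 hij))
    · exact absurd hij (hux i).ne'
    · exact absurd hij (hux j).ne
    · exact congrArg Sum.inr (Subsingleton.elim i j)

theorem exists_isCyclicParam_of_isContained_wheel {n : ℕ} (hn : 3 ≤ n)
    (h : (wheel n).IsContained G) : ∃ u x, IsCyclicParam (linkGraph G u) n x := by
  obtain ⟨f⟩ := h
  have hinj := f.injective
  let y : ℕ → Fin n := fun i => ⟨i % n, Nat.mod_lt _ (by omega)⟩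
  have hub : ∀ i, G.Adj (f (Sum.inr 0)) (f (Sum.inl i)) := fun i =>
    f.toHom.map_adj (by simp [wheel, graphJoin])
  have rim : ∀ i, G.Adj (f (Sum.inl (y i))) (f (Sum.inl (y (i + 1)))) := by
    intro i
    refine f.toHom.map_adj ?_
    have : (SimpleGraph.cycleGraph n).Adj (y i) (y (i + 1)) := by
      have : NeZero n := ⟨by omega⟩
      rw [SimpleGraph.cycleGraph_adj']
      right
      have e : y (i + 1) = y i + ⟨1, by omega⟩ := by
        apply Fin.ext
        rw [Fin.val_add]
        simp [y]
      rw [e, add_sub_cancel_left]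
    simpa [wheel, graphJoin] using this
  refine ⟨f (Sum.inr 0), fun i => f (Sum.inl (y i)), fun i => ⟨rim i, hub _, hub _⟩, ?_, ?_, hn⟩
  · intro i
    simp [y]
  · intro i hi j hj e
    have := congrArg Fin.val (Sum.inl_injective (hinj e))
    simpa [y, Nat.mod_eq_of_lt hi, Nat.mod_eq_of_lt hj] using this

theorem isContained_starOfOrder_of_degree_ge {n : ℕ} {v : V} [Fintype (G.neighborSet v)]
    (h : n - 1 ≤ G.degree v) : (starOfOrder n).IsContained G := by
  obtain ⟨s, hs, hcard⟩ := Finset.exists_subset_card_eq h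
  let e : Fin (n - 1) ≃ s := (Finset.equivFinOfCardEq hcard).symm
  have hadj : ∀ i, G.Adj v (e i) := fun i => (G.mem_neighborFinset v _).1 (hs (e i).2)
  refine ⟨⟨⟨Sum.elim (fun _ => v) (fun i => e i), ?_⟩, ?_⟩⟩
  · rintro (i | i) (j | j) hij
    · simp [starOfOrder] at hij
    · exact hadj j
    · exact (hadj i).symm
    · simp [starOfOrder] at hij
  · rintro (i | i) (j | j) hij
    · exact congrArg Sum.inl (Subsingleton.elim i j)
    · exact absurd hij (hadj j).ne
    · exact absurd hij (hadj i).ne'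
    · exact congrArg Sum.inr (e.injective (Subtype.ext hij))

theorem exists_subset_neighborSet_of_isContained_starOfOrder {n : ℕ}
    (h : (starOfOrder n).IsContained G) :
    ∃ (v : V) (s : Finset V), s.card = n - 1 ∧ ∀ w ∈ s, G.Adj v w := by
  classical
  obtain ⟨f⟩ := h
  refine ⟨f (Sum.inl 0), Finset.univ.image fun i => f (Sum.inr i), ?_, ?_⟩
  · have hinj : Function.Injective fun i => f (Sum.inr i) :=
      f.injective.comp Sum.inr_injective
    rw [Finset.card_image_of_injective _ hinj, Finset.card_univ, Fintype.card_fin]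
  · intro w hw
    obtain ⟨i, -, rfl⟩ := Finset.mem_image.1 hw
    exact f.toHom.map_adj (by simp [starOfOrder])

end Containment

/-! ### The extremal graph -/

section Extremal

variable {V : Type*}

/-- The graph on a vertex set partitioned into four classes by `p`, in which class `0` is independent
and completely joined to the other classes, class `1` is a clique, and classes `2` and `3` are the
sides of a complete bipartite graph not joined to class `1`. -/
def fourPartGraph (p : V → Fin 4) : SimpleGraph V where
  Adj a b := a ≠ b ∧ ((p a = 0 ∧ p b ≠ 0) ∨ (p a ≠ 0 ∧ p b = 0) ∨ (p a = 1 ∧ p b = 1) ∨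
    (p a = 2 ∧ p b = 3) ∨ (p a = 3 ∧ p b = 2))
  symm := ⟨fun a b h => by
    obtain ⟨h0, h⟩ := h
    exact ⟨h0.symm, by tauto⟩⟩
  loopless := ⟨fun a h => h.1 rfl⟩

/-- A vertex cover of a cycle with `2 k` vertices has at least `k` elements. -/
theorem IsCyclicParam.le_card_of_cover {G : SimpleGraph V} {k : ℕ} {x : ℕ → V}
    (hx : IsCyclicParam G (2 * k) x) {s : Finset V} (hs : ∀ i, x i ∈ s ∨ x (i + 1) ∈ s) :
    k ≤ s.card := by
  have : ∀ j, ∃ t, (t = 2 * j ∨ t = 2 * j + 1) ∧ x t ∈ s := fun j =>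
    (hs (2 * j)).elim (fun h => ⟨_, Or.inl rfl, h⟩) (fun h => ⟨_, Or.inr rfl, h⟩)
  choose t ht hts using this
  calc k = (Finset.range k).card := (Finset.card_range k).symm
    _ ≤ s.card := by
      refine Finset.card_le_card_of_injOn (fun j => x (t j)) (fun j _ => hts j) ?_
      intro i hi j hj e
      have hi' : i < k := by simpa using hi
      have hj' : j < k := by simpa using hj
      have := hx.injOn _ (by rcases ht i with h | h <;> omega) _
        (by rcases ht j with h | h <;> omega) e
      rcases ht i with h | h <;> rcases ht j with h' | h' <;> omega

theorem IsCyclicParam.le_card_of_forall_mem {G : SimpleGraph V} {c : ℕ} {x : ℕ → V}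
    (hx : IsCyclicParam G c x) {s : Finset V} (hs : ∀ i, x i ∈ s) : c ≤ s.card := by
  rw [← Finset.card_range c]
  refine Finset.card_le_card_of_injOn x (fun j _ => hs j) ?_
  intro i hi j hj e
  exact hx.injOn _ (by simpa using hi) _ (by simpa using hj) e

variable [Fintype V] {p : V → Fin 4} {k : ℕ}

theorem not_isContained_wheel_fourPartGraph (hk : 2 ≤ k)
    (h1 : (Finset.univ.filter (p · = 1)).card ≤ k)
    (h2 : (Finset.univ.filter (p · = 2)).card ≤ k - 1)
    (h3 : (Finset.univ.filter (p · = 3)).card ≤ k - 1) :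
    ¬ (wheel (2 * k)).IsContained (fourPartGraph p) := by
  classical
  intro h
  obtain ⟨u, x, hx⟩ := exists_isCyclicParam_of_isContained_wheel (by omega) h
  have hub : ∀ i, (fourPartGraph p).Adj u (x i) := fun i => (hx.adj i).2.1
  have rim : ∀ i, (fourPartGraph p).Adj (x i) (x (i + 1)) := fun i => (hx.adj i).1
  simp only [fourPartGraph] at hub rim
  have hq : ∀ q : Fin 4, q = 0 ∨ q = 1 ∨ q = 2 ∨ q = 3 := by decide
  rcases hq (p u) with hu | hu | hu | hu <;> simp only [hu] at hub
  · -- The rim avoids class `0`, so it lies in one component of the rest.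
    have h0 : ∀ i, p (x i) ≠ 0 := fun i => by simpa using (hub i).2
    have hconst : ∀ i, p (x i) = 1 ↔ p (x 0) = 1 := by
      intro i
      induction i with
      | zero => rfl
      | succ i ih =>
        rw [← ih]
        have := (rim i).2
        have hi := h0 i
        have hi' := h0 (i + 1)
        constructor <;> intro h <;> simp_all
    by_cases hx0 : p (x 0) = 1
    · have := hx.le_card_of_forall_mem (s := Finset.univ.filter (p · = 1))
        (fun i => by simpa using (hconst i).2 hx0)
      omega
    · have := hx.le_card_of_forall_mem
        (s := Finset.univ.filter (p · = 2) ∪ Finset.univ.filter (p · = 3)) (fun i => by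
          have hi := h0 i
          have hi' := (hconst i).not.2 hx0
          rcases hq (p (x i)) with e | e | e | e <;> simp_all)
      have := Finset.card_union_le (Finset.univ.filter (p · = 2)) (Finset.univ.filter (p · = 3))
      omega
  · -- Here and below, the vertices of the rim outside the independent class `0` cover the rim.
    have := hx.le_card_of_cover (s := (Finset.univ.filter (p · = 1)).erase u) (fun i => by
      have a := hub i
      have b := hub (i + 1)
      have c := (rim i).2
      by_cases e : p (x i) = 1
      · left
        simp [e, a.1.symm]
      · right
        have b2 := b.2
        have e' : p (x (i + 1)) = 1 := by
          rcases hq (p (x (i + 1))) with e1 | e1 | e1 | e1 <;> simp_all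
        simp [e', b.1.symm])
    rw [Finset.card_erase_of_mem (by simpa using hu)] at this
    omega
  · have := hx.le_card_of_cover (s := Finset.univ.filter (p · = 3)) (fun i => by
      have a := (hub i).2
      have b := (hub (i + 1)).2
      have c := (rim i).2
      simp at a b ⊢
      rcases a with a | a <;> rcases b with b | b <;> simp_all)
    omega
  · have := hx.le_card_of_cover (s := Finset.univ.filter (p · = 2)) (fun i => by
      have a := (hub i).2
      have b := (hub (i + 1)).2
      have c := (rim i).2
      simp at a b ⊢
      rcases a with a | a <;> rcases b with b | b <;> simp_all)
    omega

theorem not_isContained_starOfOrder_compl_fourPartGraph (hk : 2 ≤ k)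
    (h0 : (Finset.univ.filter (p · = 0)).card ≤ 2 * k - 1)
    (h1 : (Finset.univ.filter (p · = 1)).card ≤ k)
    (h2 : (Finset.univ.filter (p · = 2)).card ≤ k - 1)
    (h3 : (Finset.univ.filter (p · = 3)).card ≤ k - 1) :
    ¬ (starOfOrder (2 * k)).IsContained (fourPartGraph p)ᶜ := by
  classical
  intro h
  obtain ⟨v, s, hs, hv⟩ := exists_subset_neighborSet_of_isContained_starOfOrder h
  simp only [SimpleGraph.compl_adj, fourPartGraph, not_and] at hv
  have hq : ∀ q : Fin 4, q = 0 ∨ q = 1 ∨ q = 2 ∨ q = 3 := by decide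
  rcases hq (p v) with e | e | e | e <;> simp only [e] at hv
  · have := Finset.card_le_card (s := s) (t := (Finset.univ.filter (p · = 0)).erase v)
      (fun w hw => by
        obtain ⟨a, b⟩ := hv w hw
        have b := b a
        simpa [a.symm] using b)
    rw [Finset.card_erase_of_mem (by simpa using e)] at this
    omega
  · have := Finset.card_le_card (s := s)
      (t := Finset.univ.filter (p · = 2) ∪ Finset.univ.filter (p · = 3)) (fun w hw => by
        obtain ⟨a, b⟩ := hv w hw
        have b := b a
        rcases hq (p w) with e | e | e | e <;> simp_all)
    have := Finset.card_union_le (Finset.univ.filter (p · = 2)) (Finset.univ.filter (p · = 3))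
    omega
  · have := Finset.card_le_card (s := s)
      (t := Finset.univ.filter (p · = 1) ∪ (Finset.univ.filter (p · = 2)).erase v) (fun w hw => by
        obtain ⟨a, b⟩ := hv w hw
        have b := b a
        have a' := a.symm
        rcases hq (p w) with e | e | e | e <;> simp_all)
    have := Finset.card_union_le (Finset.univ.filter (p · = 1))
      ((Finset.univ.filter (p · = 2)).erase v)
    rw [Finset.card_erase_of_mem (by simpa using e)] at this
    omega
  · have := Finset.card_le_card (s := s)
      (t := Finset.univ.filter (p · = 1) ∪ (Finset.univ.filter (p · = 3)).erase v) (fun w hw => by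
        obtain ⟨a, b⟩ := hv w hw
        have b := b a
        have a' := a.symm
        rcases hq (p w) with e | e | e | e <;> simp_all)
    have := Finset.card_union_le (Finset.univ.filter (p · = 1))
      ((Finset.univ.filter (p · = 3)).erase v)
    rw [Finset.card_erase_of_mem (by simpa using e)] at this
    omega

end Extremal

/-! ### The Ramsey number -/

section Ramsey

variable {k : ℕ}

theorem isRamsey_wheel_starOfOrder (hk : 2 ≤ k) :
    IsRamsey (wheel (2 * k)) (starOfOrder (2 * k)) (5 * k - 1) := by
  classical
  refine ⟨by omega, fun G => ?_⟩
  by_cases h : ∃ v, 2 * k - 1 ≤ Gᶜ.degree v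
  · obtain ⟨v, hv⟩ := h
    exact Or.inr (isContained_starOfOrder_of_degree_ge hv)
  · push Not at h
    refine Or.inl (hasWheel_of_degree_ge (by simp) hk fun v => ?_).isContained
    have h1 := h v
    rw [SimpleGraph.degree_compl, Fintype.card_fin] at h1
    convert show 3 * k ≤ G.degree v by omega

theorem not_isRamsey_wheel_starOfOrder (hk : 2 ≤ k) {N : ℕ} (hN : N ≤ 5 * k - 3) :
    ¬ IsRamsey (wheel (2 * k)) (starOfOrder (2 * k)) N := by
  rintro ⟨-, h⟩
  let p : Fin N → Fin 4 := fun i =>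
    if i.val < 2 * k - 1 then 0 else if i.val < 3 * k - 1 then 1 else if i.val < 4 * k - 2 then 2
    else 3
  have bound : ∀ (q : Fin 4) (a b : ℕ), (∀ i : Fin N, p i = q → a ≤ i.val ∧ i.val < b) →
      (Finset.univ.filter (p · = q)).card ≤ b - a := by
    intro q a b hab
    rw [← Nat.card_Ico]
    refine Finset.card_le_card_of_injOn Fin.val ?_ Fin.val_injective.injOn
    intro i hi
    have hi' : p i = q := by simpa using hi
    simpa using hab i hi'
  have hp : ∀ i : Fin N, (i.val < 2 * k - 1 ∧ p i = 0) ∨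
      (2 * k - 1 ≤ i.val ∧ i.val < 3 * k - 1 ∧ p i = 1) ∨
      (3 * k - 1 ≤ i.val ∧ i.val < 4 * k - 2 ∧ p i = 2) ∨
      (4 * k - 2 ≤ i.val ∧ i.val < 5 * k - 3 ∧ p i = 3) := by
    intro i
    have := i.2
    simp only [p]
    split_ifs <;> simp <;> omega
  have h0 := bound 0 0 (2 * k - 1) fun i hi => by
    rcases hp i with e | e | e | e <;> simp [hi] at e; omega
  have h1 := bound 1 (2 * k - 1) (3 * k - 1) fun i hi => by
    rcases hp i with e | e | e | e <;> simp [hi] at e; omega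
  have h2 := bound 2 (3 * k - 1) (4 * k - 2) fun i hi => by
    rcases hp i with e | e | e | e <;> simp [hi] at e; omega
  have h3 := bound 3 (4 * k - 2) (5 * k - 3) fun i hi => by
    rcases hp i with e | e | e | e <;> simp [hi] at e; omega
  rcases h (fourPartGraph p) with h | h
  · exact not_isContained_wheel_fourPartGraph hk (by omega) (by omega) (by omega) h
  · exact not_isContained_starOfOrder_compl_fourPartGraph hk (by omega) (by omega) (by omega)
      (by omega) h

end Ramsey

theorem mainTheorem2 (n : ℕ) (hn : 6 ≤ n) (heven : Even n) :
    (ramseyNumber (wheel n) (starOfOrder n) : ℚ) = 5 * (n : ℚ) / 2 - 2 ∨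
      (ramseyNumber (wheel n) (starOfOrder n) : ℚ) = 5 * (n : ℚ) / 2 - 1 := by
  obtain ⟨k, rfl⟩ := heven.exists_two_nsmul
  rw [smul_eq_mul] at hn ⊢
  have hk : 2 ≤ k := by omega
  have hle : ramseyNumber (wheel (2 * k)) (starOfOrder (2 * k)) ≤ 5 * k - 1 :=
    Nat.sInf_le (isRamsey_wheel_starOfOrder hk)
  have hmem : IsRamsey (wheel (2 * k)) (starOfOrder (2 * k))
      (ramseyNumber (wheel (2 * k)) (starOfOrder (2 * k))) :=
    Nat.sInf_mem (s := {N | IsRamsey (wheel (2 * k)) (starOfOrder (2 * k)) N})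
      ⟨_, isRamsey_wheel_starOfOrder hk⟩
  have hge : ¬ ramseyNumber (wheel (2 * k)) (starOfOrder (2 * k)) ≤ 5 * k - 3 :=
    fun h => not_isRamsey_wheel_starOfOrder hk h hmem
  generalize ramseyNumber (wheel (2 * k)) (starOfOrder (2 * k)) = r at hle hge
  have hr : r + 2 = 5 * k ∨ r + 1 = 5 * k := by omega
  refine hr.imp (fun h => ?_) (fun h => ?_)
  · have : (r : ℚ) + 2 = 5 * k := by exact_mod_cast h
    push_cast
    linarith
  · have : (r : ℚ) + 1 = 5 * k := by exact_mod_cast h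
    push_cast
    linarith
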